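/- **Setting.** Let $V_L,V_R\in\mathbb C[x]$, let $\omega(x_L,x_R)$ be a complex function of two variables, and let $\int dx_L$, $\int dx_R$ be integrals along contours $\Gamma_L,\Gamma_R$ in $\mathbb C$ (countable unions of $C^1$ curves) such that, for all $a,b\ge 0$, the integral $\int dx_L\,dx_R\,e^{-V_L(x_L)-V_R(x_R)}x_L^a\,\omega(x_L,x_R)\,x_R^b$ converges absolutely. Put $$(f\mid\omega\mid g)=\int dx_L\,dx_R\,e^{-V_L(x_L)-V_R(x_R)}f(x_L)\,\omega(x_L,x_R)\,g(x_R),\qquad \Delta_n(x)=\prod_{i<j}(x_i-x_j),$$ $$Z_N=\frac1{N!^2}\int dX_L\,dX_R\;e^{-\operatorname{tr}V_L(X_L)-\operatorname{tr}V_R(X_R)}\,\Delta_N(X_L)\det_{1\le i,j\le N}\omega(x_{L,i},x_{R,j})\,\Delta_N(X_R),$$ where $X_L,X_R$ are diagonal matrices with eigenvalues $x_{L,i},x_{R,i}$, and let $\langle\,\cdot\,\rangle$ be the expectation with respect to the integrand divided by $N!^2Z_N$. Let $N,M\ge 0$ be integers. **Case $M\le N$.** Let $P_i,Q_i$ $(i\ge0)$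 be monic polynomials of degree $i$ with $(P_i\mid\omega\mid Q_j)=h_i\delta_{ij}$ and all $h_i\ne0$. Put $\phi_i=e^{-V_L}P_i/\sqrt{h_i}$, $\psi_i=e^{-V_R}Q_i/\sqrt{h_i}$, $K_n(x_R,x_L)=\sum_{i<n}\psi_i(x_R)\phi_i(x_L)$, $$\widetilde\phi_i(z)=e^{V_L(z)}\int dx_L\,dx_R\,e^{-V_L(x_L)}\frac{\omega(x_L,x_R)\psi_i(x_R)}{z-x_L},\qquad \widetilde\psi_i(w)=e^{V_R(w)}\int dx_L\,dx_R\,e^{-V_R(x_R)}\frac{\phi_i(x_L)\omega(x_L,x_R)}{w-x_R},$$ and let $\widetilde K_n(w,z)=\sum_{i=n}^\infty\widetilde\psi_i(w)\widetilde\phi_i(z)$ be the dual Christoffel–Darboux kernel. Then $$\Big\langle\prod_{\alpha=1}^M\det(z_\alpha-X_L)^{-1}\det(w_\alpha-X_R)^{-1}\Big\rangle=\frac{e^{-\operatorname{tr}V_L(Z)-\operatorname{tr}V_R(W)}}{\Delta_M(Z)\Delta_M(W)}\,\frac{Z_{N-M}}{Z_N}\det_{1\le\alpha,\beta\le M}\widetilde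 K_{N-M}(w_\beta,z_\alpha)\qquad(1)$$ in each of the following two senses. (a) Formally, without further hypotheses: $z_\alpha,w_\alpha$ are formal variables, and the left side and the entries $e^{-V_L(z_\alpha)-V_R(w_\beta)}\widetilde K_{N-M}(w_\beta,z_\alpha)$ of the determinant (which absorbs the exponential prefactor) are expanded in powers of $z_\alpha^{-1},w_\beta^{-1}$, the integrals being taken coefficientwise; only finitely many $i$ contribute to each coefficient of the kernel. (b) As an identity of complex numbers, for pairwise distinct $z_\alpha\notin\overline{\Gamma_L}$ and pairwise distinct $w_\alpha\notin\overline{\Gamma_R}$, provided that the completeness relation $\omega\,\widetilde\omega\,\omega=\omega$ with $\widetilde\omega=\lim_{n\to\infty}K_n$ holds on the functions $f=\frac1{z_\alpha-\,\cdot\,}$, $g=\frac1{w_\beta-\,\cdot\,}$ for all $\alpha,\beta$, in the sense that $$\lim_{n\to\infty}\int dx_L\,dx_R'\,dx_L'\,dx_R\;e^{-V_L(x_L)-V_R(x_R)}f(x_L)\,\omega(x_L,x_R')\,K_n(x_R',x_L')\,\omega(x_L',x_R)\,g(x_R)=(f\mid\omega\mid g).$$ Then the integral on the left of (1) converges absolutely,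 the series $\widetilde K_{N-M}(w_\beta,z_\alpha)$ converge (as limits of partial sums), and (1) holds. **Case $M\ge N$.** Let $Z_N\ne0$, let $p_i,q_i$ be arbitrary monic polynomials of degree $i$, let $z_\alpha\notin\overline{\Gamma_L}$ be pairwise distinct, and let $w_\alpha\notin\overline{\Gamma_R}$ be pairwise distinct. Let $S_{\alpha\beta}=\big(\frac1{z_\alpha-x_L}\mid\omega\mid\frac1{w_\beta-x_R}\big)$, $1\le\alpha,\beta\le M$, and, if $M>N$, let $S$ be invertible. Then the integral on the left converges absolutely and $$\Big\langle\prod_{\alpha=1}^M\det(z_\alpha-X_L)^{-1}\det(w_\alpha-X_R)^{-1}\Big\rangle=\frac{Z_N^{-1}}{\Delta_M(Z)\Delta_M(W)}\,\det S\;\det_{1\le a,b\le M-N}\Big(\sum_{\alpha,\beta=1}^M p_{a-1}(z_\alpha)\,(S^{-1})_{\beta\alpha}\,q_{b-1}(w_\beta)\Big).$$ (For $M=N$ the last determinant is empty and equals $1$.) -/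

import Mathlib

noncomputable section

namespace CoupledMatrix

open MeasureTheory

/-- An integration contour in the complex plane: a countable union of `C¹` curves, parametrized by
the open intervals that make up the open set `dom` (isolated break points are left out). -/
structure Contour where
  dom : Set ℝ
  path : ℝ → ℂ
  isOpen_dom : IsOpen dom
  contDiffOn_path : ContDiffOn ℝ 1 path dom

namespace Contour

/-- Lebesgue measure on the parameter set. -/
def param (Γ : Contour) : Measure ℝ := volume.restrict Γ.dom

/-- The velocity, so that `dx = Γ.vel t dt` along the contour. -/
def vel (Γ : Contour) (t : ℝ) : ℂ := deriv Γ.path t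

/-- The closure of the set of points of the contour. -/
def support (Γ : Contour) : Set ℂ := closure (Γ.path '' Γ.dom)

end Contour

/-- The data of a coupled matrix model: polynomial potentials, a two-variable function and the
contours for the left and the right eigenvalues. -/
structure Model where
  VL : Polynomial ℂ
  VR : Polynomial ℂ
  ω : ℂ → ℂ → ℂ
  ΓL : Contour
  ΓR : Contour

/-- `Δ_n(x) = ∏_{i < j} (x_i - x_j)`. -/
def vandermonde {R : Type*} [CommRing R] {n : ℕ} (x : Fin n → R) : R :=
  ∏ i, ∏ j ∈ Finset.Ioi i, (x i - x j)

/-- A family of monic polynomials `p_i(x) = x^i + ⋯`. -/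
def IsMonicFamily (p : ℕ → Polynomial ℂ) : Prop :=
  ∀ i, (p i).Monic ∧ (p i).natDegree = i

/-- `det (z - X)` for `X = diag (x_1, …, x_n)`. -/
def charDet {n : ℕ} (x : Fin n → ℂ) (z : ℂ) : ℂ :=
  (z • (1 : Matrix (Fin n) (Fin n) ℂ) - Matrix.diagonal x).det

/-- The expansion of `1 / (z - x)` at `z = ∞`, as the formal power series `u / (1 - x u)` in the
variable `u = 1 / z` with index `s`. -/
def cauchySeries {σ : Type*} (s : σ) (x : ℂ) : MvPowerSeries σ ℂ :=
  MvPowerSeries.X s * (1 - MvPowerSeries.C x * MvPowerSeries.X s)⁻¹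

namespace Model

variable (𝓜 : Model)

/-- `∫ dx_L dx_R F(x_L, x_R)` along the two contours. -/
def integral₂ (F : ℂ → ℂ → ℂ) : ℂ :=
  ∫ t : ℝ × ℝ, F (𝓜.ΓL.path t.1) (𝓜.ΓR.path t.2) * (𝓜.ΓL.vel t.1 * 𝓜.ΓR.vel t.2)
    ∂(𝓜.ΓL.param.prod 𝓜.ΓR.param)

/-- Absolute convergence of `∫ dx_L dx_R F(x_L, x_R)`. -/
def Integrable₂ (F : ℂ → ℂ → ℂ) : Prop :=
  Integrable (fun t : ℝ × ℝ =>
      F (𝓜.ΓL.path t.1) (𝓜.ΓR.path t.2) * (𝓜.ΓL.vel t.1 * 𝓜.ΓR.vel t.2))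
    (𝓜.ΓL.param.prod 𝓜.ΓR.param)

/-- The bracket without potentials, `∫ dx_L dx_R f(x_L) ω(x_L, x_R) g(x_R)`. -/
def pairing (f g : ℂ → ℂ) : ℂ :=
  𝓜.integral₂ fun x y => f x * 𝓜.ω x y * g y

/-- The bracket with potentials,
`(f | ω | g) = ∫ dx_L dx_R e^{-V_L(x_L) - V_R(x_R)} f(x_L) ω(x_L, x_R) g(x_R)`. -/
def bracket (f g : ℂ → ℂ) : ℂ :=
  𝓜.integral₂ fun x y =>
    Complex.exp (-𝓜.VL.eval x) * Complex.exp (-𝓜.VR.eval y) * (f x * 𝓜.ω x y * g y)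

/-- The contours make the two-variable integrals of all monomials converge absolutely. -/
def Converges : Prop :=
  ∀ a b : ℕ, 𝓜.Integrable₂ fun x y =>
    Complex.exp (-𝓜.VL.eval x) * Complex.exp (-𝓜.VR.eval y) * (x ^ a * 𝓜.ω x y * y ^ b)

/-- The unnormalized density
`e^{-tr V_L(X_L) - tr V_R(X_R)} Δ_N(X_L) det ω(x_{L,i}, x_{R,j}) Δ_N(X_R)`. -/
def density (N : ℕ) (x y : Fin N → ℂ) : ℂ :=
  Complex.exp (-∑ i, 𝓜.VL.eval (x i)) * Complex.exp (-∑ i, 𝓜.VR.eval (y i)) *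
    (vandermonde x * (Matrix.of fun i j => 𝓜.ω (x i) (y j)).det * vandermonde y)

/-- The integrand of the `2N`-fold eigenvalue integral of `F`, in the contour parameters. -/
def eigIntegrand (N : ℕ) (F : (Fin N → ℂ) → (Fin N → ℂ) → ℂ)
    (t : (Fin N → ℝ) × (Fin N → ℝ)) : ℂ :=
  F (fun i => 𝓜.ΓL.path (t.1 i)) (fun i => 𝓜.ΓR.path (t.2 i)) *
    ((∏ i, 𝓜.ΓL.vel (t.1 i)) * ∏ i, 𝓜.ΓR.vel (t.2 i))

/-- The product Lebesgue measure on the parameters of the `2N` eigenvalues. -/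
def eigParam (N : ℕ) : Measure ((Fin N → ℝ) × (Fin N → ℝ)) :=
  (Measure.pi fun _ => 𝓜.ΓL.param).prod (Measure.pi fun _ => 𝓜.ΓR.param)

/-- `∫ dX_L dX_R F(X_L, X_R)` over `N` left and `N` right eigenvalues. -/
def eigIntegral (N : ℕ) (F : (Fin N → ℂ) → (Fin N → ℂ) → ℂ) : ℂ :=
  ∫ t, 𝓜.eigIntegrand N F t ∂(𝓜.eigParam N)

/-- The partition function `Z_N`. -/
def partitionFunction (N : ℕ) : ℂ :=
  1 / (N.factorial : ℂ) ^ 2 * 𝓜.eigIntegral N (𝓜.density N)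

/-- The normalized distribution `P_N(X_L, X_R)`. -/
def distribution (N : ℕ) (x y : Fin N → ℂ) : ℂ :=
  (𝓜.partitionFunction N)⁻¹ / (N.factorial : ℂ) ^ 2 * 𝓜.density N x y

/-- The expectation value of an observable. -/
def expectation (N : ℕ) (O : (Fin N → ℂ) → (Fin N → ℂ) → ℂ) : ℂ :=
  𝓜.eigIntegral N fun x y => 𝓜.distribution N x y * O x y

/-- Absolute convergence of the integral that defines the expectation value. -/
def HasExpectation (N : ℕ) (O : (Fin N → ℂ) → (Fin N → ℂ) → ℂ) : Prop :=
  Integrable (𝓜.eigIntegrand N fun x y => 𝓜.distribution N x y * O x y) (𝓜.eigParam N)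

/-- `P_i`, `Q_i` are the monic biorthogonal polynomials, `(P_i | ω | Q_j) = h_i δ_{ij}`, with
nonzero norms `h_i`. -/
structure IsBiorthogonal (P Q : ℕ → Polynomial ℂ) (h : ℕ → ℂ) : Prop where
  monic_left : IsMonicFamily P
  monic_right : IsMonicFamily Q
  orthogonal : ∀ i j, 𝓜.bracket (fun x => (P i).eval x) (fun y => (Q j).eval y) =
    if i = j then h i else 0
  norm_ne_zero : ∀ i, h i ≠ 0

section Kernel

variable (P Q : ℕ → Polynomial ℂ) (h : ℕ → ℂ)

/-- The wave function `φ_i(x) = e^{-V_L(x)} P_i(x) / √h_i`. -/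
def φ (i : ℕ) (x : ℂ) : ℂ :=
  Complex.exp (-𝓜.VL.eval x) / (h i) ^ (1 / 2 : ℂ) * (P i).eval x

/-- The wave function `ψ_i(x) = e^{-V_R(x)} Q_i(x) / √h_i`. -/
def ψ (i : ℕ) (y : ℂ) : ℂ :=
  Complex.exp (-𝓜.VR.eval y) / (h i) ^ (1 / 2 : ℂ) * (Q i).eval y

/-- The Christoffel–Darboux kernel `K_n(x_R, x_L) = ∑_{i < n} ψ_i(x_R) φ_i(x_L)`. -/
def cdKernel (n : ℕ) (y x : ℂ) : ℂ :=
  ∑ i ∈ Finset.range n, 𝓜.ψ Q h i y * 𝓜.φ P h i x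

/-- The completeness relation `ω · ω̃ · ω = ω` for `ω̃ = lim_{n → ∞} K_n`, tested (with the weights
`e^{-V_L}`, `e^{-V_R}`) against `f` on the left and `g` on the right:
`∫ e^{-V_L(x) - V_R(y)} f(x) ω(x, y') K_n(y', x') ω(x', y) g(y) → (f | ω | g)`. The first pair of
parameters is `(x, y')`, the second one is `(x', y)`. -/
def IsCompleteOn (f g : ℂ → ℂ) : Prop :=
  Filter.Tendsto
    (fun n : ℕ =>
      ∫ t : (ℝ × ℝ) × (ℝ × ℝ),
        (Complex.exp (-𝓜.VL.eval (𝓜.ΓL.path t.1.1)) * f (𝓜.ΓL.path t.1.1) *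
            𝓜.ω (𝓜.ΓL.path t.1.1) (𝓜.ΓR.path t.1.2) *
            𝓜.cdKernel P Q h n (𝓜.ΓR.path t.1.2) (𝓜.ΓL.path t.2.1) *
            𝓜.ω (𝓜.ΓL.path t.2.1) (𝓜.ΓR.path t.2.2) *
            (g (𝓜.ΓR.path t.2.2) * Complex.exp (-𝓜.VR.eval (𝓜.ΓR.path t.2.2)))) *
          ((𝓜.ΓL.vel t.1.1 * 𝓜.ΓR.vel t.1.2) * (𝓜.ΓL.vel t.2.1 * 𝓜.ΓR.vel t.2.2))
        ∂((𝓜.ΓL.param.prod 𝓜.ΓR.param).prod (𝓜.ΓL.param.prod 𝓜.ΓR.param)))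
    Filter.atTop (nhds (𝓜.bracket f g))

/-- The dual wave function
`φ̃_i(z) = e^{V_L(z)} ∫ dx_L dx_R e^{-V_L(x_L)} ω(x_L, x_R) ψ_i(x_R) / (z - x_L)`. -/
def dualφ (i : ℕ) (z : ℂ) : ℂ :=
  Complex.exp (𝓜.VL.eval z) *
    𝓜.pairing (fun x => Complex.exp (-𝓜.VL.eval x) * (1 / (z - x))) (𝓜.ψ Q h i)

/-- The dual wave function
`ψ̃_i(w) = e^{V_R(w)} ∫ dx_L dx_R e^{-V_R(x_R)} φ_i(x_L) ω(x_L, x_R) / (w - x_R)`. -/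
def dualψ (i : ℕ) (w : ℂ) : ℂ :=
  Complex.exp (𝓜.VR.eval w) *
    𝓜.pairing (𝓜.φ P h i) (fun y => Complex.exp (-𝓜.VR.eval y) * (1 / (w - y)))

/-- The terms `ψ̃_{n+i}(w) φ̃_{n+i}(z)`, `i = 0, 1, …`, of the dual kernel. -/
def dualKernelTerm (n : ℕ) (w z : ℂ) (i : ℕ) : ℂ :=
  𝓜.dualψ P h (n + i) w * 𝓜.dualφ Q h (n + i) z

/-- The dual Christoffel–Darboux kernel `K̃_n(w, z) = ∑_{i = n}^∞ ψ̃_i(w) φ̃_i(z)`, the limit of the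
partial sums. -/
def dualKernel (n : ℕ) (w z : ℂ) : ℂ :=
  ∑'[SummationFilter.conditional ℕ] i, 𝓜.dualKernelTerm P Q h n w z i

/-! Expansions at infinity: `u_α = 1 / z_α` is the variable with index `Sum.inl α`, and
`v_β = 1 / w_β` the one with index `Sum.inr β`. Integrals are taken coefficientwise. -/

/-- The expansion of `e^{-V_L(z_α)} φ̃_i(z_α)` in `u_α = 1 / z_α`. -/
def formalDualφ {M : ℕ} (i : ℕ) (α : Fin M) : MvPowerSeries (Fin M ⊕ Fin M) ℂ :=
  fun e => 𝓜.pairing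
    (fun x => Complex.exp (-𝓜.VL.eval x) *
      MvPowerSeries.coeff e (cauchySeries (Sum.inl α : Fin M ⊕ Fin M) x))
    (𝓜.ψ Q h i)

/-- The expansion of `e^{-V_R(w_β)} ψ̃_i(w_β)` in `v_β = 1 / w_β`. -/
def formalDualψ {M : ℕ} (i : ℕ) (β : Fin M) : MvPowerSeries (Fin M ⊕ Fin M) ℂ :=
  fun e => 𝓜.pairing (𝓜.φ P h i)
    (fun y => Complex.exp (-𝓜.VR.eval y) *
      MvPowerSeries.coeff e (cauchySeries (Sum.inr β : Fin M ⊕ Fin M) y))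

/-- The terms of the formal dual kernel. -/
def formalDualKernelTerm {M : ℕ} (n : ℕ) (β α : Fin M) (i : ℕ) :
    MvPowerSeries (Fin M ⊕ Fin M) ℂ :=
  𝓜.formalDualψ P h (n + i) β * 𝓜.formalDualφ Q h (n + i) α

/-- The expansion of `e^{-V_L(z_α) - V_R(w_β)} K̃_n(w_β, z_α)`, summed coefficientwise. -/
def formalDualKernel {M : ℕ} (n : ℕ) (β α : Fin M) : MvPowerSeries (Fin M ⊕ Fin M) ℂ :=
  fun e => ∑' i : ℕ, MvPowerSeries.coeff e (𝓜.formalDualKernelTerm P Q h n β α i)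

end Kernel

/-- The expansion of `⟨∏_α det (z_α - X_L)⁻¹ det (w_α - X_R)⁻¹⟩` in the variables `u_α`, `v_α`. -/
def formalInversePairCorrelation (N M : ℕ) : MvPowerSeries (Fin M ⊕ Fin M) ℂ :=
  fun e => 𝓜.expectation N fun x y =>
    MvPowerSeries.coeff e
      (∏ α : Fin M, ((∏ i, cauchySeries (Sum.inl α : Fin M ⊕ Fin M) (x i)) *
        ∏ i, cauchySeries (Sum.inr α : Fin M ⊕ Fin M) (y i)))

/-- The observable `∏_α det (z_α - X_L)⁻¹ det (w_α - X_R)⁻¹`. -/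
def inversePair {N M : ℕ} (z w : Fin M → ℂ) (x y : Fin N → ℂ) : ℂ :=
  ∏ α, (charDet x (z α))⁻¹ * (charDet y (w α))⁻¹

/-- The matrix `(1 / (z_α - x_L) | ω | 1 / (w_β - x_R))`. -/
def resolventMatrix {M : ℕ} (z w : Fin M → ℂ) : Matrix (Fin M) (Fin M) ℂ :=
  Matrix.of fun α β => 𝓜.bracket (fun x => 1 / (z α - x)) (fun y => 1 / (w β - y))

end Model

end CoupledMatrix

end

/-! Each factor `1 / det (z_α - X)` is absorbed into the adjacent Vandermonde determinant, and the
Andréief identity then turns the `2N`-fold integral into `N!²` times one `N × N` determinant of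
brackets.

For `M ≤ N`, put `K = N - M`. Up to a sign, `Δ_M(z) Δ_N(x) ∏ (z_α - x_i)⁻¹` is a confluent Cauchy
determinant with `M` rows `1 / (z_α - x_i)` and `K` rows of monic polynomials `P_j(x_i)`
(`det_cauchyMatrix_mul`). In the resulting matrix of brackets the polynomial block is `diag(h_0, …,
h_{K-1})`, whose determinant is `Z_K`. The Schur complement of this block has the entries `S_{αβ} -
∑_{i<K} (1/(z_α-x)|ω|Q_i) h_i⁻¹ (P_i|ω|1/(w_β-y))`. Completeness says that the same sum over all `i`
gives `S_{αβ}`, so the entry is the tail `i ≥ K`, which is the dual kernel without its exponential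
prefactors.

Formally, every coefficient of `1/(z-x)` at infinity is a polynomial in `x`. Completeness is then a
theorem: `P_i` annihilates polynomials of degree below `i`, so each coefficient of the expansion is
a finite sum (`IsBiorthogonal.sum_coeff_formalTerm`). To serve both versions, Andréief is proved for
coefficientwise integrals of power series; the numerical form is the case of no variables.

For `M ≥ N`, `x^a / ∏ (z_α - x)` with `a < N` is a combination of the `1/(z_α - x)`, so the matrix
of brackets is the leading `N × N` block of `U S Vᵀ` with weighted Vandermonde matrices `U`, `V`.
Jacobi's identity trades this minor for the complementary minor of the inverse, and the monic
polynomials `p`, `q` extract exactly that minor (`det_sum_weightedVandermonde_mul`). -/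

namespace CoupledMatrix

open Matrix Finset Polynomial MeasureTheory

/-! ### Partial fractions, confluent Cauchy determinants and complementary minors -/

section Algebra

variable {R : Type*} [CommRing R] {F : Type*} [Field F]

/-- The sign that relates the two conventions for the Vandermonde determinant. -/
def vandermondeSign (n : ℕ) : ℤˣ := ∏ i : Fin n, (-1) ^ #(Ioi i)

lemma vandermonde_eq_sign_smul {n : ℕ} (x : Fin n → R) :
    vandermonde x = ((vandermondeSign n : ℤ) : R) * (Matrix.vandermonde x).det := by
  rw [det_vandermonde, vandermonde, vandermondeSign]
  push_cast
  rw [← prod_mul_distrib]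
  refine prod_congr rfl fun i _ => ?_
  rw [← prod_const, ← prod_mul_distrib]
  exact prod_congr rfl fun j _ => by ring

lemma units_int_cast_mul_self (u : ℤˣ) : ((u : ℤ) : R) * ((u : ℤ) : R) = 1 := by
  rcases Int.units_eq_one_or u with rfl | rfl <;> simp

/-- The sign between the two conventions depends only on `n`, so it squares to one; Vandermonde
determinants of `x` and `y` always occur in pairs. -/
lemma vandermonde_mul_vandermonde {n : ℕ} (x y : Fin n → R) :
    vandermonde x * vandermonde y =
      (Matrix.vandermonde x).det * (Matrix.vandermonde y).det := by
  rw [vandermonde_eq_sign_smul, vandermonde_eq_sign_smul, mul_mul_mul_comm,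
    units_int_cast_mul_self, one_mul]

lemma det_mul_pow {n : ℕ} (v x : Fin n → R) :
    (Matrix.of fun a i : Fin n => v i * x i ^ (a : ℕ)).det =
      (∏ i, v i) * (Matrix.vandermonde x).det := by
  rw [← det_transpose (Matrix.vandermonde x), ← det_mul_row]
  rfl

lemma det_vandermonde_map {S : Type*} [CommRing S] {n : ℕ} (f : R →+* S) (x : Fin n → R) :
    (Matrix.vandermonde fun i => f (x i)).det = f (Matrix.vandermonde x).det := by
  simp [det_vandermonde]

/-- The weights in the partial fraction decomposition of `p / ∏_α (z_α - x)`. -/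
def nodeWeight {M : ℕ} (z : Fin M → F) (α : Fin M) : F := ∏ β ∈ {α}ᶜ, (z β - z α)⁻¹

lemma nodalWeight_eq {M : ℕ} (z : Fin M → F) (α : Fin M) :
    Lagrange.nodalWeight univ z α = (-1) ^ (M - 1) * nodeWeight z α := by
  have : #({α}ᶜ : Finset (Fin M)) = M - 1 := by simp [card_compl]
  rw [Lagrange.nodalWeight, nodeWeight, ← this, ← prod_const, ← prod_mul_distrib]
  refine prod_congr (by ext; simp) fun j _ => ?_
  rw [← neg_sub, inv_neg]
  ring

/-- Lagrange interpolation at the nodes `z`, in barycentric form, divided by the nodal polynomial.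
The degree bound excludes a polynomial part. -/
lemma sum_eval_mul_nodeWeight_mul_inv {M : ℕ} {z : Fin M → F} (hz : Function.Injective z) {x : F}
    (hx : ∀ α, z α ≠ x) {p : F[X]} (hp : p.degree < M) :
    ∑ α, p.eval (z α) * nodeWeight z α * (z α - x)⁻¹ = p.eval x * ∏ α, (z α - x)⁻¹ := by
  rcases Nat.eq_zero_or_pos M with rfl | hM
  · have : p = 0 := by
      rw [← degree_eq_bot]
      simpa [degree_lt_iff_coeff_zero, Polynomial.ext_iff] using hp
    simp [this]
  have h := Lagrange.eq_interpolate (s := univ) (v := z) hz.injOn (f := p) (by simpa using hp)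
  have h2 : ∏ α, (z α - x) ≠ 0 := prod_ne_zero_iff.2 fun α _ => sub_ne_zero.2 (hx α)
  have h3 : p.eval x = (∏ α, (z α - x)) *
      ∑ α, p.eval (z α) * nodeWeight z α * (z α - x)⁻¹ := by
    conv_lhs => rw [h, Lagrange.eval_interpolate_not_at_node _ (fun i _ => (hx i).symm),
      Lagrange.eval_nodal]
    have h4 : ∏ i, (x - z i) = (-1) ^ M * ∏ i, (z i - x) := by
      have : (-1 : F) ^ M = ∏ _i : Fin M, (-1) := by simp
      rw [this, ← prod_mul_distrib]
      exact prod_congr rfl fun j _ => by ring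
    rw [h4, mul_assoc, mul_left_comm, mul_sum]
    congr 1
    refine sum_congr rfl fun i _ => ?_
    rw [nodalWeight_eq, ← neg_sub, inv_neg]
    obtain ⟨m, rfl⟩ := Nat.exists_eq_add_of_lt hM
    have : ((-1 : F) ^ m) * (-1) ^ m = 1 := by rw [← mul_pow]; simp
    simp only [zero_add, Nat.add_sub_cancel, pow_succ]
    linear_combination (p.eval (z i) * nodeWeight z i * (z i - x)⁻¹) * this
  rw [h3, prod_inv_distrib]
  field_simp

/-- The coefficient of `x^(M-1)` in the Lagrange interpolant. In particular the weights annihilate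
all polynomials of degree below `M - 1`. -/
lemma sum_eval_mul_nodeWeight {M : ℕ} {z : Fin M → F} (hz : Function.Injective z)
    {p : F[X]} (hp : p.degree < M) :
    ∑ α, p.eval (z α) * nodeWeight z α = (-1) ^ (M - 1) * p.coeff (M - 1) := by
  have h := Lagrange.coeff_eq_sum (s := univ) (v := z) hz.injOn (P := p) (by simpa using hp)
  simp only [card_univ, Fintype.card_fin] at h
  rw [h, mul_sum]
  refine sum_congr rfl fun i _ => ?_
  rw [div_eq_mul_inv, ← prod_inv_distrib]
  change _ = _ * (_ * Lagrange.nodalWeight univ z i)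
  rw [nodalWeight_eq]
  have : ((-1 : F) ^ (M - 1)) * (-1) ^ (M - 1) = 1 := by rw [← mul_pow]; simp
  linear_combination (-(p.eval (z i) * nodeWeight z i)) * this

/-- The matrix of the partial fraction decompositions of `x^a / ∏_α (z_α - x)`. -/
def weightedVandermonde {M : ℕ} (z : Fin M → F) : Matrix (Fin M) (Fin M) F :=
  Matrix.of fun a α => z α ^ (a : ℕ) * nodeWeight z α

lemma det_weightedVandermonde_mul {M : ℕ} {z : Fin M → F} (hz : Function.Injective z) :
    (weightedVandermonde z).det * (Matrix.vandermonde z).det = ((vandermondeSign M : ℤ) : F) := by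
  have h1 : weightedVandermonde z = (Matrix.vandermonde z)ᵀ * Matrix.diagonal (nodeWeight z) := by
    ext a α
    simp [weightedVandermonde, Matrix.vandermonde]
  have h2 : ∏ α, nodeWeight z α = (vandermonde z * (Matrix.vandermonde z).det)⁻¹ := by
    simp only [nodeWeight, prod_inv_distrib]
    rw [← prod_prod_Ioi_mul_eq_prod_prod_off_diag (fun i j => z i - z j)]
    simp only [prod_mul_distrib]
    rw [← det_vandermonde, ← vandermonde, mul_comm]
  have h3 : (Matrix.vandermonde z).det ≠ 0 := det_vandermonde_ne_zero_iff.2 hz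
  have h4 := units_int_cast_mul_self (R := F) (vandermondeSign M)
  have h5 : ((vandermondeSign M : ℤ) : F) ≠ 0 := left_ne_zero_of_mul_eq_one h4
  rw [h1, det_mul, det_transpose, det_diagonal, h2, vandermonde_eq_sign_smul]
  field_simp
  rw [sq, h4]

/-- The matrix with rows `1 / (z_α - x_i)` and `P_j(x_i)`. -/
def cauchyMatrix {M K N : ℕ} (z : Fin M → F) (P : ℕ → F[X]) (x : Fin N → F) :
    Matrix (Fin M ⊕ Fin K) (Fin N) F :=
  Matrix.of fun a i => Sum.elim (fun α => (z α - x i)⁻¹) (fun j : Fin K => (P j).eval (x i)) a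

/-- The sign in the evaluation of the confluent Cauchy determinant. -/
def cauchySign (M K : ℕ) : ℤˣ := vandermondeSign M * ((-1) ^ M) ^ K

/-- The Cauchy determinant extended by rows of monic polynomials. -/
theorem det_cauchyMatrix_mul {M K : ℕ} {z : Fin M → F} (hz : Function.Injective z)
    {P : ℕ → F[X]} (hP : ∀ i, (P i).Monic ∧ (P i).natDegree = i) {x : Fin (M + K) → F}
    (hx : ∀ α i, z α ≠ x i) :
    ((cauchyMatrix z P x).submatrix id finSumFinEquiv :
        Matrix (Fin M ⊕ Fin K) (Fin M ⊕ Fin K) F).det =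
      ((cauchySign M K : ℤ) : F) * ((Matrix.vandermonde z).det * ((Matrix.vandermonde x).det *
        ∏ α, ∏ i, (z α - x i)⁻¹)) := by
  set C : Matrix (Fin M ⊕ Fin K) (Fin M ⊕ Fin K) F :=
    (cauchyMatrix z P x).submatrix id finSumFinEquiv with hC
  let D : Fin (M + K) → F := fun i => ∏ α, (z α - x i)
  have hD : ∀ i, D i ≠ 0 := fun i => prod_ne_zero_iff.2 fun α _ => sub_ne_zero.2 (hx α i)
  let A : Matrix (Fin M ⊕ Fin K) (Fin M ⊕ Fin K) F :=
    fromBlocks (weightedVandermonde z) 0 0 (Matrix.diagonal fun _ => (-1) ^ M)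
  let r : Fin (M + K) → F[X] := fun a => Sum.elim (fun a : Fin M => X ^ (a : ℕ))
    (fun j : Fin K => Lagrange.nodal univ z * P j) (finSumFinEquiv.symm a)
  have hr1 : ∀ a, (r a).Monic := fun a => by
    obtain ⟨b, rfl⟩ := finSumFinEquiv.surjective a
    rcases b with b | b
    · simp [r, monic_X_pow]
    · simpa [r] using Lagrange.nodal_monic.mul (hP b).1
  have hr2 : ∀ a, (r a).natDegree = a := fun a => by
    obtain ⟨b, rfl⟩ := finSumFinEquiv.surjective a
    rcases b with b | b
    · simp [r]
    · have := Lagrange.nodal_monic (s := univ) (v := z) |>.natDegree_mul (hP b).1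
      simp [r, this, (hP b).2]
  -- After clearing the denominators `D`, the Cauchy rows combine to `x^a` with `a < M`, and the
  -- other rows become the nodal polynomial times `P_j`. These are monic of degrees `0, …, M + K -
  -- 1`, so their determinant is the Vandermonde determinant of `x`.
  have key : A * C * Matrix.diagonal (fun i => D (finSumFinEquiv i)) =
      ((Matrix.of fun i a => (r a).eval (x i)).submatrix finSumFinEquiv finSumFinEquiv)ᵀ := by
    ext a i
    rw [mul_diagonal, Matrix.mul_apply, Fintype.sum_sum_type]
    rcases a with a | a
    · have := sum_eval_mul_nodeWeight_mul_inv hz (fun α => hx α (finSumFinEquiv i))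
        (p := X ^ (a : ℕ)) (by rw [degree_X_pow]; exact_mod_cast a.2)
      simp only [A, fromBlocks_apply₁₁, fromBlocks_apply₁₂, Matrix.zero_apply, zero_mul, sum_const_zero, add_zero,
        hC, submatrix_apply, id, cauchyMatrix, of_apply, Sum.elim_inl, transpose_apply, r,
        Equiv.symm_apply_apply, weightedVandermonde]
      simp only [eval_pow, eval_X] at this ⊢
      rw [this, mul_assoc, ← prod_mul_distrib, prod_eq_one, mul_one]
      intro α _
      exact inv_mul_cancel₀ (sub_ne_zero.2 (hx _ _))
    · simp only [A, fromBlocks_apply₂₁, fromBlocks_apply₂₂, Matrix.zero_apply, zero_mul, sum_const_zero, zero_add,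
        hC, submatrix_apply, id, cauchyMatrix, of_apply, Sum.elim_inr, transpose_apply, r,
        Equiv.symm_apply_apply, diagonal_apply, ite_mul, sum_ite_eq, mem_univ, if_true, eval_mul,
        Lagrange.eval_nodal, D]
      have : (-1 : F) ^ M = ∏ _i : Fin M, (-1) := by simp
      rw [this, mul_right_comm, ← prod_mul_distrib]
      congr 1
      exact prod_congr rfl fun j _ => by ring
  have h1 := congrArg det key
  rw [det_transpose, det_submatrix_equiv_self, ← det_eval_matrixOfPolynomials_eq_det_vandermonde
    x r hr2 hr1, det_mul, det_mul, det_fromBlocks_zero₂₁, det_diagonal, det_diagonal,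
    prod_const, card_univ, Fintype.card_fin] at h1
  have h2 : ∏ i, D (finSumFinEquiv i) = ∏ i, D i := Equiv.prod_comp _ D
  have h3 : ∏ i, D i ≠ 0 := prod_ne_zero_iff.2 fun i _ => hD i
  have h4 : ∏ α, ∏ i, (z α - x i)⁻¹ = (∏ i, D i)⁻¹ := by
    rw [prod_comm]; simp [D]
  rw [h4, ← h1, h2]
  have h5 := det_weightedVandermonde_mul hz
  have h6 := units_int_cast_mul_self (R := F) (cauchySign M K)
  have h7 : ((cauchySign M K : ℤ) : F) = ((vandermondeSign M : ℤ) : F) * ((-1) ^ M) ^ K := by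
    simp [cauchySign]
  field_simp
  linear_combination (-(C.det)) * h6 - C.det * ((cauchySign M K : ℤ) : F) * ((-1) ^ M) ^ K * h5 + C.det * ((cauchySign M K : ℤ) : F) * h7

/-- The Schur complement of the diagonal block. Explicit inverses `g` over a commutative ring allow
its use both for numbers and for power series. -/
lemma det_fromBlocks_diagonal {m k : Type*} [Fintype m] [DecidableEq m] [Fintype k]
    [DecidableEq k] (S : Matrix m m R) (X : Matrix m k R) (Y : Matrix k m R) (h g : k → R)
    (hg : ∀ i, h i * g i = 1) :
    (fromBlocks S X Y (Matrix.diagonal h)).det =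
      (∏ i, h i) * (Matrix.of fun a b => S a b - ∑ i, X a i * g i * Y i b).det := by
  let : Invertible (Matrix.diagonal h) := ⟨Matrix.diagonal g,
    by simp [diagonal_mul_diagonal, mul_comm (g _), hg],
    by simp [diagonal_mul_diagonal, hg]⟩
  rw [det_fromBlocks₂₂, det_diagonal]
  congr 2
  ext a b
  change S a b - (X * Matrix.diagonal g * Y) a b = _
  rw [Matrix.mul_apply]
  simp_rw [Matrix.mul_diagonal]
  rfl

/-- Jacobi's identity for complementary minors of inverse matrices. -/
lemma det_toBlocks₁₁_eq {m k : Type*} [Fintype m] [DecidableEq m] [Fintype k] [DecidableEq k]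
    {T X : Matrix (m ⊕ k) (m ⊕ k) R} (h : T * X = 1) :
    T.toBlocks₁₁.det = T.det * X.toBlocks₂₂.det := by
  -- The second block column of `T * X = 1` is `(0, 1)`; taking determinants of both sides gives the
  -- claim.
  have h1 : T * fromBlocks 1 X.toBlocks₁₂ 0 X.toBlocks₂₂ = fromBlocks T.toBlocks₁₁ 0 T.toBlocks₂₁ 1 := by
    rw [← fromBlocks_toBlocks T, ← fromBlocks_toBlocks X, fromBlocks_multiply, ← fromBlocks_one, fromBlocks_inj] at h
    conv_lhs => rw [← fromBlocks_toBlocks T]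
    rw [fromBlocks_multiply]
    simp [h.2.1, h.2.2.2]
  have h2 := congrArg det h1
  rwa [det_mul, det_fromBlocks_zero₂₁, det_fromBlocks_zero₁₂, det_one, det_one, one_mul, mul_one,
    eq_comm] at h2

/-- The sums read off the coefficient of `x^(N+K-1)` in `X^a * p_b`, which has degree `a + b`. It
vanishes in the first `N` rows, and the last `K` rows become triangular once they are reversed. The
resulting sign does not depend on `z` or `p`. -/
lemma det_weightedVandermonde_mul_eval {N K : ℕ} {z : Fin (N + K) → F} (hz : Function.Injective z)
    {p : ℕ → F[X]} (hp : ∀ i, (p i).Monic ∧ (p i).natDegree = i) :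
    (∀ (a : Fin N) (b : Fin K), ∑ α, weightedVandermonde z (Fin.castAdd K a) α * (p b).eval (z α) = 0) ∧
    (Matrix.of fun a b : Fin K =>
      ∑ α, weightedVandermonde z (Fin.natAdd N a) α * (p b).eval (z α)).det =
      (((Equiv.Perm.sign (Fin.revPerm (n := K)) * ((-1) ^ (N + K - 1)) ^ K : ℤˣ) : ℤ) : F) := by
  have hm : ∀ (a : ℕ) (b : Fin K), (X ^ a * p b).Monic := fun a b => (monic_X_pow a).mul (hp b).1
  have hn : ∀ (a : ℕ) (b : Fin K), (X ^ a * p b).natDegree = a + b := fun a b => by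
    rw [(monic_X_pow a).natDegree_mul (hp b).1, natDegree_X_pow, (hp b).2]
  have hs : ∀ (a : ℕ) (b : Fin K), a + b < N + K →
      ∑ α, (z α ^ a * nodeWeight z α) * (p b).eval (z α) =
        (-1) ^ (N + K - 1) * (X ^ a * p b).coeff (N + K - 1) := fun a b hab => by
    rw [← sum_eval_mul_nodeWeight hz]
    · exact sum_congr rfl fun α _ => by simp; ring
    · rw [degree_eq_natDegree (hm a b).ne_zero, hn]
      exact_mod_cast hab
  constructor
  · intro a b
    simp only [weightedVandermonde, of_apply, Fin.val_castAdd]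
    rw [hs _ _ (by omega), coeff_eq_zero_of_natDegree_lt (by rw [hn]; omega), mul_zero]
  · set J := (Matrix.of fun a b : Fin K =>
      ∑ α, weightedVandermonde z (Fin.natAdd N a) α * (p b).eval (z α)) with hJ
    -- Above the diagonal the degree reaches `N + K`, where the coefficient formula fails; those
    -- entries do not affect a triangular determinant.
    have hJ' : ∀ a b : Fin K, (b : ℕ) ≤ a → J.submatrix Fin.revPerm id a b =
        (-1) ^ (N + K - 1) * (X ^ (N + (K - (a + 1))) * p b).coeff (N + K - 1) := by
      intro a b hab
      simp only [hJ, weightedVandermonde, of_apply, submatrix_apply, Fin.val_natAdd, id,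
        Fin.revPerm_apply, Fin.val_rev]
      rw [hs _ _ (by omega)]
    have h1 : (J.submatrix Fin.revPerm id).det = ((-1) ^ (N + K - 1)) ^ K := by
      rw [det_of_isUpperTriangular]
      · rw [prod_congr rfl (g := fun _ => (-1) ^ (N + K - 1)), prod_const, card_univ,
          Fintype.card_fin]
        intro a _
        rw [hJ' a a le_rfl]
        have := (hm (N + (K - (a + 1))) a).coeff_natDegree
        rw [hn] at this
        rw [show N + K - 1 = N + (K - (a + 1)) + a by omega, this, mul_one]
      · intro a b hab
        have hab : b < a := hab
        rw [hJ' a b hab.le, coeff_eq_zero_of_natDegree_lt, mul_zero]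
        rw [hn]; omega
    rw [det_permute] at h1
    have h2 := units_int_cast_mul_self (R := F) (Equiv.Perm.sign (Fin.revPerm (n := K)))
    push_cast
    rw [← h1, ← mul_assoc, h2, one_mul]

/-- A minor of a matrix sandwiched between weighted Vandermonde matrices, in terms of the
complementary minor of the inverse. -/
theorem det_sum_weightedVandermonde_mul {N K : ℕ} {z w : Fin (N + K) → F}
    (hz : Function.Injective z) (hw : Function.Injective w) {p q : ℕ → F[X]}
    (hp : ∀ i, (p i).Monic ∧ (p i).natDegree = i) (hq : ∀ i, (q i).Monic ∧ (q i).natDegree = i)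
    (S : Matrix (Fin (N + K)) (Fin (N + K)) F) (hS : 0 < K → IsUnit S.det) :
    (Matrix.of fun a b : Fin N => ∑ α, ∑ β, weightedVandermonde z (Fin.castAdd K a) α * S α β *
        weightedVandermonde w (Fin.castAdd K b) β).det *
      ((Matrix.vandermonde z).det * (Matrix.vandermonde w).det) =
    S.det * (Matrix.of fun a b : Fin K => ∑ α, ∑ β,
      (p a).eval (z α) * S⁻¹ β α * (q b).eval (w β)).det := by
  set U := weightedVandermonde z
  set V := weightedVandermonde w
  set T := U * S * Vᵀ with hT
  have hUV : U.det * (Matrix.vandermonde z).det * (V.det * (Matrix.vandermonde w).det) = 1 := by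
    rw [det_weightedVandermonde_mul hz, det_weightedVandermonde_mul hw, units_int_cast_mul_self]
  have hTdet : T.det * ((Matrix.vandermonde z).det * (Matrix.vandermonde w).det) = S.det := by
    rw [hT, det_mul, det_mul, det_transpose]
    linear_combination S.det * hUV
  have h11 : (Matrix.of fun a b : Fin N => ∑ α, ∑ β, U (Fin.castAdd K a) α * S α β *
      V (Fin.castAdd K b) β) = (T.submatrix finSumFinEquiv finSumFinEquiv).toBlocks₁₁ := by
    ext a b
    simp only [of_apply, toBlocks₁₁, submatrix_apply, hT, Matrix.mul_apply, transpose_apply,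
      finSumFinEquiv_apply_left, sum_mul]
    exact sum_comm
  rw [h11]
  rcases Nat.eq_zero_or_pos K with rfl | hK
  -- For `K = 0` the minor is the whole determinant, and `S` may be singular.
  · have h1 : (T.submatrix finSumFinEquiv finSumFinEquiv).toBlocks₁₁.det = T.det := by
      rw [← det_submatrix_equiv_self finSumFinEquiv T,
        ← fromBlocks_toBlocks (T.submatrix finSumFinEquiv finSumFinEquiv)]
      have : (T.submatrix finSumFinEquiv finSumFinEquiv).toBlocks₂₁ = 0 := by
        ext a; exact a.elim0
      rw [this, det_fromBlocks_zero₂₁]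
      simp
    rw [h1, hTdet]
    simp
  · have hS' := hS hK
    have hU : IsUnit U.det := by
      refine isUnit_iff_ne_zero.2 fun h => ?_
      simp [h] at hUV
    have hV : IsUnit V.det := by
      refine isUnit_iff_ne_zero.2 fun h => ?_
      simp [h] at hUV
    have hTu : IsUnit T.det := by
      rw [hT, det_mul, det_mul, det_transpose]
      exact (hU.mul hS').mul hV
    have h2 : T.submatrix finSumFinEquiv finSumFinEquiv *
        (T⁻¹).submatrix finSumFinEquiv finSumFinEquiv =
        (1 : Matrix (Fin N ⊕ Fin K) (Fin N ⊕ Fin K) F) := by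
      rw [submatrix_mul_equiv, mul_nonsing_inv _ hTu, submatrix_one_equiv]
    rw [det_toBlocks₁₁_eq h2, det_submatrix_equiv_self, mul_right_comm, hTdet]
    congr 1
    obtain ⟨hz0, hzJ⟩ := det_weightedVandermonde_mul_eval hz hp
    obtain ⟨hw0, hwJ⟩ := det_weightedVandermonde_mul_eval hw hq
    set Jz := (Matrix.of fun a b : Fin K => ∑ α, U (Fin.natAdd N a) α * (p b).eval (z α))
    set Jw := (Matrix.of fun a b : Fin K => ∑ α, V (Fin.natAdd N a) α * (q b).eval (w α))
    let Bz : Matrix (Fin (N + K)) (Fin K) F := Matrix.of fun α b => (p b).eval (z α)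
    let Bw : Matrix (Fin (N + K)) (Fin K) F := Matrix.of fun α b => (q b).eval (w α)
    -- Inserting `U⁻¹ U` and `V⁻¹ V` turns `S⁻¹` into `T⁻¹`. Since `U * Bz` and `V * Bw` vanish in
    -- their first `N` rows, only the lower right block of `T⁻¹` survives, flanked by two matrices
    -- whose determinants are the same sign.
    have h3 : (Matrix.of fun a b : Fin K => ∑ α, ∑ β,
        (p a).eval (z α) * S⁻¹ β α * (q b).eval (w β)) = (U * Bz)ᵀ * (T⁻¹)ᵀ * (V * Bw) := by
      have : (U * Bz)ᵀ * (T⁻¹)ᵀ * (V * Bw) = Bzᵀ * (S⁻¹)ᵀ * Bw := by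
        have hTi : (T⁻¹)ᵀ = (U⁻¹)ᵀ * ((S⁻¹)ᵀ * V⁻¹) := by
          rw [hT, Matrix.mul_inv_rev, Matrix.mul_inv_rev, transpose_mul, transpose_mul,
            transpose_nonsing_inv Vᵀ, transpose_transpose, Matrix.mul_assoc]
        have hUi : Uᵀ * (U⁻¹)ᵀ = 1 := by
          rw [← transpose_mul, nonsing_inv_mul _ hU, transpose_one]
        rw [hTi, transpose_mul]
        simp only [Matrix.mul_assoc]
        rw [← Matrix.mul_assoc Uᵀ, hUi, Matrix.one_mul, ← Matrix.mul_assoc V⁻¹,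
          nonsing_inv_mul _ hV, Matrix.one_mul]
      rw [this]
      ext a b
      simp only [of_apply, Matrix.mul_apply, transpose_apply, sum_mul, Bz, Bw]
      exact sum_comm
    have h4 : (U * Bz)ᵀ * (T⁻¹)ᵀ * (V * Bw) =
        Jzᵀ * ((T⁻¹).submatrix finSumFinEquiv finSumFinEquiv).toBlocks₂₂ᵀ * Jw := by
      ext a b
      rw [Matrix.mul_apply, Matrix.mul_apply, Fin.sum_univ_add]
      have hw0' : ∀ i, (V * Bw) (Fin.castAdd K i) b = 0 := fun i => hw0 i b
      simp only [hw0', mul_zero, sum_const_zero, zero_add]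
      refine sum_congr rfl fun j _ => ?_
      congr 1
      rw [Matrix.mul_apply, Matrix.mul_apply, Fin.sum_univ_add]
      have hz0' : ∀ i, (U * Bz)ᵀ a (Fin.castAdd K i) = 0 := fun i => hz0 i a
      simp only [hz0', zero_mul, sum_const_zero, zero_add]
      rfl
    rw [h3, h4, det_mul, det_mul, det_transpose, det_transpose, hzJ, hwJ, mul_right_comm,
      units_int_cast_mul_self, one_mul]

end Algebra

/-! ### The Andréief identity for coefficientwise integrals -/

section Andreief

variable {σ X Y : Type*} [MeasurableSpace X] [MeasurableSpace Y] {μ : Measure X} {ν : Measure Y}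

/-- The coefficientwise integral of a function with values in power series exists and is `r`. -/
def HasCoeffIntegral (G : X → MvPowerSeries σ ℂ) (r : MvPowerSeries σ ℂ) (μ : Measure X) : Prop :=
  ∀ e, Integrable (fun t => MvPowerSeries.coeff e (G t)) μ ∧
    ∫ t, MvPowerSeries.coeff e (G t) ∂μ = MvPowerSeries.coeff e r

namespace HasCoeffIntegral

lemma const_mul {G : X → MvPowerSeries σ ℂ} {r : MvPowerSeries σ ℂ}
    (hG : HasCoeffIntegral G r μ) (c : MvPowerSeries σ ℂ) :
    HasCoeffIntegral (fun t => c * G t) (c * r) μ := by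
  classical
  intro e
  simp only [MvPowerSeries.coeff_mul]
  have h : ∀ p ∈ antidiagonal e, Integrable
      (fun t => MvPowerSeries.coeff p.1 c * MvPowerSeries.coeff p.2 (G t)) μ :=
    fun p _ => (hG p.2).1.const_mul _
  refine ⟨integrable_finsetSum _ h, ?_⟩
  rw [integral_finsetSum _ h]
  exact sum_congr rfl fun p _ => by rw [integral_const_mul, (hG p.2).2]

lemma sum {ι : Type*} {s : Finset ι} {G : ι → X → MvPowerSeries σ ℂ} {r : ι → MvPowerSeries σ ℂ}
    (hG : ∀ i ∈ s, HasCoeffIntegral (G i) (r i) μ) :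
    HasCoeffIntegral (fun t => ∑ i ∈ s, G i t) (∑ i ∈ s, r i) μ := by
  intro e
  simp only [map_sum]
  refine ⟨integrable_finsetSum _ fun i hi => (hG i hi e).1, ?_⟩
  rw [integral_finsetSum _ fun i hi => (hG i hi e).1]
  exact sum_congr rfl fun i hi => (hG i hi e).2

lemma congr {G G' : X → MvPowerSeries σ ℂ} {r : MvPowerSeries σ ℂ}
    (hG : HasCoeffIntegral G r μ) (h : ∀ t, G' t = G t) : HasCoeffIntegral G' r μ := by
  rwa [funext h]

lemma unique {G G' : X → MvPowerSeries σ ℂ} {r r' : MvPowerSeries σ ℂ}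
    (hG : HasCoeffIntegral G r μ) (hG' : HasCoeffIntegral G' r' μ) (h : ∀ t, G t = G' t) :
    r = r' := by
  ext e
  rw [← (hG e).2, ← (hG' e).2, funext h]

lemma comp_measurableEquiv {G : Y → MvPowerSeries σ ℂ} {r : MvPowerSeries σ ℂ}
    (hG : HasCoeffIntegral G r ν) (f : X ≃ᵐ Y) (hf : MeasurePreserving f μ ν) :
    HasCoeffIntegral (fun t => G (f t)) r μ := fun e =>
  ⟨hf.integrable_comp_of_integrable (hG e).1, by
    rw [← (hG e).2]
    exact hf.integral_comp' (fun t => MvPowerSeries.coeff e (G t))⟩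

lemma pi_prod {ι : Type*} [Fintype ι] [SigmaFinite μ] {G : ι → X → MvPowerSeries σ ℂ}
    {r : ι → MvPowerSeries σ ℂ} (hG : ∀ i, HasCoeffIntegral (G i) (r i) μ) :
    HasCoeffIntegral (fun t : ι → X => ∏ i, G i (t i)) (∏ i, r i) (Measure.pi fun _ => μ) := by
  classical
  intro e
  simp only [MvPowerSeries.coeff_prod]
  have h : ∀ l ∈ finsuppAntidiag (univ : Finset ι) e, Integrable
      (fun t : ι → X => ∏ i, MvPowerSeries.coeff (l i) (G i (t i))) (Measure.pi fun _ => μ) :=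
    fun l _ => Integrable.fintype_prod (f := fun i t => MvPowerSeries.coeff (l i) (G i t))
      fun i => (hG i (l i)).1
  refine ⟨integrable_finsetSum _ h, ?_⟩
  rw [integral_finsetSum _ h]
  refine sum_congr rfl fun l _ => ?_
  rw [integral_fintype_prod_eq_prod (fun i t => MvPowerSeries.coeff (l i) (G i t))]
  exact prod_congr rfl fun i _ => (hG i (l i)).2

end HasCoeffIntegral

lemma hasCoeffIntegral_C {G : X → ℂ} {r : ℂ} (hG : Integrable G μ) (hr : ∫ t, G t ∂μ = r) :
    HasCoeffIntegral (fun t => (MvPowerSeries.C (G t) : MvPowerSeries σ ℂ)) (MvPowerSeries.C r)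
      μ := by
  classical
  intro e
  simp only [MvPowerSeries.coeff_C]
  split_ifs
  · exact ⟨hG, hr⟩
  · simp

/-- For fixed `τ` the sum over `σ` is the determinant of `B` with columns permuted by `τ`, whose
sign cancels the sign of `τ`. All choices of `τ` contribute equally. -/
lemma sum_sign_mul_sign_mul_prod {R ι : Type*} [CommRing R] [Fintype ι] [DecidableEq ι]
    (B : Matrix ι ι R) :
    ∑ σ : Equiv.Perm ι, ∑ τ : Equiv.Perm ι, ((Equiv.Perm.sign σ : ℤ) : R) *
      (((Equiv.Perm.sign τ : ℤ) : R) * ∏ i, B (σ i) (τ i)) =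
      ((Fintype.card ι).factorial : R) * B.det := by
  rw [sum_comm]
  have : ∀ τ : Equiv.Perm ι, ∑ σ : Equiv.Perm ι, ((Equiv.Perm.sign σ : ℤ) : R) *
      (((Equiv.Perm.sign τ : ℤ) : R) * ∏ i, B (σ i) (τ i)) = B.det := by
    intro τ
    have h1 : ∑ σ : Equiv.Perm ι, ((Equiv.Perm.sign σ : ℤ) : R) * ∏ i, B (σ i) (τ i) =
        (B.submatrix id τ).det := by
      rw [det_apply']
      rfl
    simp_rw [mul_left_comm]
    rw [← mul_sum, h1, det_permute', ← mul_assoc, units_int_cast_mul_self, one_mul]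
  simp [this, Fintype.card_perm]

/-- The one-point form of the Andréief identity. -/
lemma hasCoeffIntegral_det_mul_prod_mul_det [SigmaFinite μ] {N : ℕ}
    {f g : Fin N → X → MvPowerSeries σ ℂ} {w : X → MvPowerSeries σ ℂ}
    {B : Matrix (Fin N) (Fin N) (MvPowerSeries σ ℂ)}
    (h : ∀ a b, HasCoeffIntegral (fun t => f a t * w t * g b t) (B a b) μ) :
    HasCoeffIntegral (fun t : Fin N → X => (Matrix.of fun a i => f a (t i)).det * (∏ i, w (t i)) *
      (Matrix.of fun a i => g a (t i)).det) ((N.factorial : MvPowerSeries σ ℂ) * B.det)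
      (Measure.pi fun _ => μ) := by
  have h1 := HasCoeffIntegral.sum (s := univ) fun (ρ : Equiv.Perm (Fin N)) _ =>
    HasCoeffIntegral.sum (s := univ) fun (τ : Equiv.Perm (Fin N)) _ =>
      ((HasCoeffIntegral.pi_prod fun i => h (ρ i) (τ i)).const_mul
        ((Equiv.Perm.sign τ : ℤ) : MvPowerSeries σ ℂ)).const_mul
        ((Equiv.Perm.sign ρ : ℤ) : MvPowerSeries σ ℂ)
  rw [sum_sign_mul_sign_mul_prod, Fintype.card_fin] at h1
  convert h1 using 2 with t
  rw [det_apply', det_apply', sum_mul, sum_mul]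
  refine sum_congr rfl fun ρ _ => ?_
  rw [mul_sum]
  refine sum_congr rfl fun τ _ => ?_
  simp only [of_apply, prod_mul_distrib]
  ring

/-- The Andréief identity for a two-variable weight. -/
theorem hasCoeffIntegral_det_mul_det_mul_det [SigmaFinite μ] [SigmaFinite ν] {N : ℕ}
    {f : Fin N → X → MvPowerSeries σ ℂ} {g : Fin N → Y → MvPowerSeries σ ℂ} {w : X → Y → ℂ}
    {B : Matrix (Fin N) (Fin N) (MvPowerSeries σ ℂ)}
    (h : ∀ a b, HasCoeffIntegral (fun t : X × Y => f a t.1 * MvPowerSeries.C (w t.1 t.2) * g b t.2)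
      (B a b) (μ.prod ν)) :
    HasCoeffIntegral (fun t : (Fin N → X) × (Fin N → Y) => (Matrix.of fun a i => f a (t.1 i)).det *
      MvPowerSeries.C (Matrix.of fun i j => w (t.1 i) (t.2 j)).det *
      (Matrix.of fun a i => g a (t.2 i)).det) ((N.factorial : MvPowerSeries σ ℂ) ^ 2 * B.det)
      ((Measure.pi fun _ => μ).prod (Measure.pi fun _ => ν)) := by
  have h1 := hasCoeffIntegral_det_mul_prod_mul_det
    (f := fun a (t : X × Y) => f a t.1) (g := fun a (t : X × Y) => g a t.2)
    (w := fun t : X × Y => MvPowerSeries.C (w t.1 t.2)) h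
  have h2 := h1.comp_measurableEquiv (MeasurableEquiv.arrowProdEquivProdArrow X Y (Fin N)).symm
    (measurePreserving_arrowProdEquivProdArrow X Y (Fin N) (fun _ => μ) (fun _ => ν)).symm
  -- Each `π` in the expansion of `det w` is removed by relabelling the `Y` variables: its sign is
  -- absorbed by the determinant of `g`, and the integral is the one-point form on `X × Y`. This is
  -- the second factor `N!`.
  have h3 : ∀ π : Equiv.Perm (Fin N), _ := fun π => h2.comp_measurableEquiv
    (μ := (Measure.pi fun _ => μ).prod (Measure.pi fun _ => ν))
    ((MeasurableEquiv.refl (Fin N → X)).prodCongr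
      (MeasurableEquiv.arrowCongr' π.symm (MeasurableEquiv.refl Y)))
    ((MeasurePreserving.id _).prod (measurePreserving_arrowCongr' (fun _ => ν) (fun _ => ν) π.symm
      (MeasurableEquiv.refl Y) fun _ => MeasurePreserving.id _))
  have h4 := HasCoeffIntegral.sum (s := univ) fun π _ => h3 π
  rw [sum_const, card_univ, Fintype.card_perm, Fintype.card_fin, nsmul_eq_mul, ← mul_assoc,
    ← sq] at h4
  convert h4 using 2 with t
  have h5 : (Matrix.of fun i j => w (t.1 i) (t.2 j)).det =
      ∑ π : Equiv.Perm (Fin N), ((Equiv.Perm.sign π : ℤ) : ℂ) * ∏ i, w (t.1 i) (t.2 (π i)) := by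
    rw [← det_transpose, det_apply']
    rfl
  rw [h5, map_sum, mul_sum, sum_mul]
  refine sum_congr rfl fun π _ => ?_
  have h6 : (Matrix.of fun a i => g a (t.2 (π i))).det =
      ((Equiv.Perm.sign π : ℤ) : MvPowerSeries σ ℂ) * (Matrix.of fun a i => g a (t.2 i)).det := by
    rw [← det_permute']
    rfl
  rw [map_mul, map_prod, map_intCast]
  change _ = (Matrix.of fun a i => f a (t.1 i)).det *
    (∏ i, MvPowerSeries.C (w (t.1 i) (t.2 (π i)))) * (Matrix.of fun a i => g a (t.2 (π i))).det
  rw [h6]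
  ring

end Andreief

/-! ### Cauchy kernels along a contour -/

namespace Contour

variable (Γ : Contour)

instance : SigmaFinite Γ.param := by unfold param; infer_instance

lemma ae_mem_dom : ∀ᵐ t ∂Γ.param, t ∈ Γ.dom :=
  ae_restrict_mem Γ.isOpen_dom.measurableSet

lemma ne_path {z : ℂ} (hz : z ∉ Γ.support) {t : ℝ} (ht : t ∈ Γ.dom) : z ≠ Γ.path t := fun h =>
  hz (subset_closure ⟨t, ht, h.symm⟩)

lemma aestronglyMeasurable_inv_sub (z : ℂ) :
    AEStronglyMeasurable (fun t => (z - Γ.path t)⁻¹) Γ.param := by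
  have h : AEStronglyMeasurable Γ.path Γ.param :=
    Γ.contDiffOn_path.continuousOn.aestronglyMeasurable Γ.isOpen_dom.measurableSet
  exact (aestronglyMeasurable_const.sub h).aemeasurable.inv.aestronglyMeasurable

/-- A whole ball of radius `δ` around `z` misses the contour, so the Cauchy kernel is bounded by
`δ⁻¹`. Absolute convergence thus passes from polynomials to rational functions. -/
lemma exists_norm_inv_sub_le {z : ℂ} (hz : z ∉ Γ.support) :
    ∃ c, ∀ t ∈ Γ.dom, ‖(z - Γ.path t)⁻¹‖ ≤ c := by
  obtain ⟨δ, hδ, h⟩ := Metric.isOpen_iff.1 isClosed_closure.isOpen_compl z hz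
  refine ⟨δ⁻¹, fun t ht => ?_⟩
  rw [norm_inv]
  refine inv_anti₀ hδ (not_lt.1 fun hlt => ?_)
  exact h (show Γ.path t ∈ Metric.ball z δ by rwa [Metric.mem_ball, dist_comm, dist_eq_norm])
    (subset_closure ⟨t, ht, rfl⟩)

end Contour

/-! ### Brackets: convergence and linearity -/

namespace Model

variable (𝓜 : Model)

/-- The weight of the bracket in the contour parameters. -/
noncomputable def weight (s t : ℝ) : ℂ :=
  Complex.exp (-𝓜.VL.eval (𝓜.ΓL.path s)) * Complex.exp (-𝓜.VR.eval (𝓜.ΓR.path t)) *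
    𝓜.ω (𝓜.ΓL.path s) (𝓜.ΓR.path t) * (𝓜.ΓL.vel s * 𝓜.ΓR.vel t)

/-- Absolute convergence of the bracket. -/
def BracketIntegrable (f g : ℂ → ℂ) : Prop :=
  Integrable (fun t : ℝ × ℝ => f (𝓜.ΓL.path t.1) * 𝓜.weight t.1 t.2 * g (𝓜.ΓR.path t.2))
    (𝓜.ΓL.param.prod 𝓜.ΓR.param)

variable {𝓜}

lemma bracket_eq (f g : ℂ → ℂ) : 𝓜.bracket f g =
    ∫ t : ℝ × ℝ, f (𝓜.ΓL.path t.1) * 𝓜.weight t.1 t.2 * g (𝓜.ΓR.path t.2)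
      ∂(𝓜.ΓL.param.prod 𝓜.ΓR.param) := by
  rw [bracket, integral₂]
  congr 1
  ext t
  rw [weight]
  ring

lemma BracketIntegrable.sum_left {ι : Type*} {s : Finset ι} {f : ι → ℂ → ℂ} {g : ℂ → ℂ}
    (h : ∀ i ∈ s, 𝓜.BracketIntegrable (f i) g) (c : ι → ℂ) :
    𝓜.BracketIntegrable (fun x => ∑ i ∈ s, c i * f i x) g := by
  simp only [BracketIntegrable, sum_mul, mul_assoc]
  exact integrable_finsetSum _ fun i hi => by
    simpa only [BracketIntegrable, mul_assoc] using (h i hi).const_mul (c i)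

lemma BracketIntegrable.sum_right {ι : Type*} {s : Finset ι} {f : ℂ → ℂ} {g : ι → ℂ → ℂ}
    (h : ∀ i ∈ s, 𝓜.BracketIntegrable f (g i)) (c : ι → ℂ) :
    𝓜.BracketIntegrable f (fun x => ∑ i ∈ s, c i * g i x) := by
  simp only [BracketIntegrable, mul_sum, mul_left_comm _ (c _)]
  exact integrable_finsetSum _ fun i hi => (h i hi).const_mul (c i)

lemma bracket_sum_left {ι : Type*} {s : Finset ι} {f : ι → ℂ → ℂ} {g : ℂ → ℂ}
    (h : ∀ i ∈ s, 𝓜.BracketIntegrable (f i) g) (c : ι → ℂ) :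
    𝓜.bracket (fun x => ∑ i ∈ s, c i * f i x) g = ∑ i ∈ s, c i * 𝓜.bracket (f i) g := by
  simp only [bracket_eq, sum_mul, mul_assoc]
  rw [integral_finsetSum]
  · simp only [integral_const_mul]
  · exact fun i hi => by
      simpa only [BracketIntegrable, mul_assoc] using (h i hi).const_mul (c i)

lemma bracket_sum_right {ι : Type*} {s : Finset ι} {f : ℂ → ℂ} {g : ι → ℂ → ℂ}
    (h : ∀ i ∈ s, 𝓜.BracketIntegrable f (g i)) (c : ι → ℂ) :
    𝓜.bracket f (fun y => ∑ i ∈ s, c i * g i y) = ∑ i ∈ s, c i * 𝓜.bracket f (g i) := by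
  simp only [bracket_eq, mul_sum, mul_left_comm _ (c _)]
  rw [integral_finsetSum]
  · simp only [integral_const_mul]
  · exact fun i hi => (h i hi).const_mul (c i)

lemma ae_mem_dom_prod : ∀ᵐ t ∂(𝓜.ΓL.param.prod 𝓜.ΓR.param), t.1 ∈ 𝓜.ΓL.dom ∧ t.2 ∈ 𝓜.ΓR.dom :=
  (Measure.quasiMeasurePreserving_fst.ae 𝓜.ΓL.ae_mem_dom).and
    (Measure.quasiMeasurePreserving_snd.ae 𝓜.ΓR.ae_mem_dom)

lemma bracket_congr {f f' g g' : ℂ → ℂ}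
    (hf : ∀ t ∈ 𝓜.ΓL.dom, f (𝓜.ΓL.path t) = f' (𝓜.ΓL.path t))
    (hg : ∀ t ∈ 𝓜.ΓR.dom, g (𝓜.ΓR.path t) = g' (𝓜.ΓR.path t)) :
    𝓜.bracket f g = 𝓜.bracket f' g' := by
  rw [bracket_eq, bracket_eq]
  refine integral_congr_ae ?_
  filter_upwards [ae_mem_dom_prod] with t ht
  rw [hf _ ht.1, hg _ ht.2]

lemma Converges.bracketIntegrable_eval (h : 𝓜.Converges) (p q : ℂ[X]) :
    𝓜.BracketIntegrable (fun x => p.eval x) (fun y => q.eval y) := by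
  simp only [eval_eq_sum, Polynomial.sum_def]
  refine BracketIntegrable.sum_left (fun a _ => BracketIntegrable.sum_right (fun b _ => ?_) _) _
  refine (h a b).congr (Filter.Eventually.of_forall fun t => ?_)
  simp only [weight]
  ring

lemma BracketIntegrable.inv_sub_left {f g : ℂ → ℂ} (h : 𝓜.BracketIntegrable f g) {z : ℂ}
    (hz : z ∉ 𝓜.ΓL.support) : 𝓜.BracketIntegrable (fun x => (z - x)⁻¹ * f x) g := by
  obtain ⟨c, hc⟩ := 𝓜.ΓL.exists_norm_inv_sub_le hz
  simp only [BracketIntegrable, mul_assoc]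
  refine Integrable.bdd_mul (c := c) (by simpa only [BracketIntegrable, mul_assoc] using h)
    ((𝓜.ΓL.aestronglyMeasurable_inv_sub z).comp_quasiMeasurePreserving
      Measure.quasiMeasurePreserving_fst) ?_
  filter_upwards [ae_mem_dom_prod] with t ht using hc _ ht.1

lemma BracketIntegrable.inv_sub_right {f g : ℂ → ℂ} (h : 𝓜.BracketIntegrable f g) {w : ℂ}
    (hw : w ∉ 𝓜.ΓR.support) : 𝓜.BracketIntegrable f (fun y => (w - y)⁻¹ * g y) := by
  obtain ⟨c, hc⟩ := 𝓜.ΓR.exists_norm_inv_sub_le hw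
  simp only [BracketIntegrable, mul_left_comm _ (_ - _)⁻¹]
  refine Integrable.bdd_mul (c := c) h
    ((𝓜.ΓR.aestronglyMeasurable_inv_sub w).comp_quasiMeasurePreserving
      Measure.quasiMeasurePreserving_snd) ?_
  filter_upwards [ae_mem_dom_prod] with t ht using hc _ ht.2

lemma Converges.bracketIntegrable_rational (h : 𝓜.Converges) (p q : ℂ[X]) {ι κ : Type*}
    {z : ι → ℂ} {w : κ → ℂ} (hz : ∀ i, z i ∉ 𝓜.ΓL.support) (hw : ∀ i, w i ∉ 𝓜.ΓR.support)
    (s : Finset ι) (t : Finset κ) :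
    𝓜.BracketIntegrable (fun x => (∏ i ∈ s, (z i - x)⁻¹) * p.eval x)
      (fun y => (∏ i ∈ t, (w i - y)⁻¹) * q.eval y) := by
  classical
  induction s using Finset.induction_on with
  | empty =>
    induction t using Finset.induction_on with
    | empty => simpa using h.bracketIntegrable_eval p q
    | insert i t hi ih => simpa only [prod_insert hi, mul_assoc] using ih.inv_sub_right (hw i)
  | insert i s hi ih => simpa only [prod_insert hi, mul_assoc] using ih.inv_sub_left (hz i)

lemma Converges.bracketIntegrable_inv_eval (h : 𝓜.Converges) (q : ℂ[X]) {z : ℂ}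
    (hz : z ∉ 𝓜.ΓL.support) :
    𝓜.BracketIntegrable (fun x => (z - x)⁻¹) (fun y => q.eval y) := by
  simpa using (h.bracketIntegrable_eval 1 q).inv_sub_left hz

lemma Converges.bracketIntegrable_eval_inv (h : 𝓜.Converges) (p : ℂ[X]) {w : ℂ}
    (hw : w ∉ 𝓜.ΓR.support) :
    𝓜.BracketIntegrable (fun x => p.eval x) (fun y => (w - y)⁻¹) := by
  simpa using (h.bracketIntegrable_eval p 1).inv_sub_right hw

lemma Converges.bracketIntegrable_inv_inv (h : 𝓜.Converges) {z w : ℂ}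
    (hz : z ∉ 𝓜.ΓL.support) (hw : w ∉ 𝓜.ΓR.support) :
    𝓜.BracketIntegrable (fun x => (z - x)⁻¹) (fun y => (w - y)⁻¹) := by
  simpa using ((h.bracketIntegrable_eval 1 1).inv_sub_right hw).inv_sub_left hz

/-! Reduction of eigenvalue integrals to brackets. -/

/-- The determinant of the weights carries the potentials and the Jacobians of all eigenvalues. -/
lemma det_weight {N : ℕ} (t : (Fin N → ℝ) × (Fin N → ℝ)) :
    (Matrix.of fun i j => 𝓜.weight (t.1 i) (t.2 j)).det =
      Complex.exp (-∑ i, 𝓜.VL.eval (𝓜.ΓL.path (t.1 i))) *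
        Complex.exp (-∑ i, 𝓜.VR.eval (𝓜.ΓR.path (t.2 i))) *
        (Matrix.of fun i j => 𝓜.ω (𝓜.ΓL.path (t.1 i)) (𝓜.ΓR.path (t.2 j))).det *
        ((∏ i, 𝓜.ΓL.vel (t.1 i)) * ∏ i, 𝓜.ΓR.vel (t.2 i)) := by
  have h : (Matrix.of fun i j => 𝓜.weight (t.1 i) (t.2 j)) = Matrix.of fun i j =>
      (Complex.exp (-𝓜.VR.eval (𝓜.ΓR.path (t.2 j))) * 𝓜.ΓR.vel (t.2 j)) *
        Matrix.of (fun i j => (Complex.exp (-𝓜.VL.eval (𝓜.ΓL.path (t.1 i))) * 𝓜.ΓL.vel (t.1 i)) *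
        Matrix.of (fun i j => 𝓜.ω (𝓜.ΓL.path (t.1 i)) (𝓜.ΓR.path (t.2 j))) i j) i j := by
    ext i j
    simp only [of_apply, weight]
    ring
  rw [h, det_mul_row, det_mul_column, ← sum_neg_distrib, ← sum_neg_distrib, Complex.exp_sum,
    Complex.exp_sum, prod_mul_distrib, prod_mul_distrib]
  ring

/-- With potentials and Jacobians moved into the middle determinant, the integrand has the shape
required by Andréief. -/
lemma eigIntegrand_density_mul {N : ℕ} (O : (Fin N → ℂ) → (Fin N → ℂ) → ℂ)
    (t : (Fin N → ℝ) × (Fin N → ℝ)) :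
    𝓜.eigIntegrand N (fun x y => 𝓜.density N x y * O x y) t =
      (Matrix.vandermonde fun i => 𝓜.ΓL.path (t.1 i)).det *
        (Matrix.vandermonde fun i => 𝓜.ΓR.path (t.2 i)).det *
        (Matrix.of fun i j => 𝓜.weight (t.1 i) (t.2 j)).det *
        O (fun i => 𝓜.ΓL.path (t.1 i)) (fun i => 𝓜.ΓR.path (t.2 i)) := by
  rw [← vandermonde_mul_vandermonde, det_weight, eigIntegrand, density]
  ring

lemma hasExpectation_of_integrable {N : ℕ} {O : (Fin N → ℂ) → (Fin N → ℂ) → ℂ}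
    (h : Integrable (𝓜.eigIntegrand N fun x y => 𝓜.density N x y * O x y) (𝓜.eigParam N)) :
    𝓜.HasExpectation N O := by
  refine (h.const_mul ((𝓜.partitionFunction N)⁻¹ / (N.factorial : ℂ) ^ 2)).congr
    (Filter.Eventually.of_forall fun t => ?_)
  simp only [eigIntegrand, distribution]
  ring

lemma expectation_eq {N : ℕ} (O : (Fin N → ℂ) → (Fin N → ℂ) → ℂ) :
    𝓜.expectation N O = (𝓜.partitionFunction N)⁻¹ / (N.factorial : ℂ) ^ 2 *
      ∫ t, 𝓜.eigIntegrand N (fun x y => 𝓜.density N x y * O x y) t ∂(𝓜.eigParam N) := by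
  rw [expectation, eigIntegral, ← integral_const_mul]
  congr 1
  ext t
  simp only [eigIntegrand, distribution]
  ring

/-- Power series in no variables are constants, so the numerical Andréief identity is the zeroth
coefficient over `Empty`. -/
lemma det_mul_det_weight_mul_det {N : ℕ} {f g : Fin N → ℂ → ℂ}
    (h : ∀ a b, 𝓜.BracketIntegrable (f a) (g b)) :
    Integrable (fun t : (Fin N → ℝ) × (Fin N → ℝ) =>
      (Matrix.of fun a i => f a (𝓜.ΓL.path (t.1 i))).det *
        (Matrix.of fun i j => 𝓜.weight (t.1 i) (t.2 j)).det *
        (Matrix.of fun a i => g a (𝓜.ΓR.path (t.2 i))).det) (𝓜.eigParam N) ∧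
    ∫ t : (Fin N → ℝ) × (Fin N → ℝ),
      (Matrix.of fun a i => f a (𝓜.ΓL.path (t.1 i))).det *
        (Matrix.of fun i j => 𝓜.weight (t.1 i) (t.2 j)).det *
        (Matrix.of fun a i => g a (𝓜.ΓR.path (t.2 i))).det ∂(𝓜.eigParam N) =
      (N.factorial : ℂ) ^ 2 * (Matrix.of fun a b => 𝓜.bracket (f a) (g b)).det := by
  have h1 := hasCoeffIntegral_det_mul_det_mul_det (σ := Empty)
    (f := fun a s => MvPowerSeries.C (f a (𝓜.ΓL.path s)))
    (g := fun a s => MvPowerSeries.C (g a (𝓜.ΓR.path s))) (w := 𝓜.weight)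
    (B := (MvPowerSeries.C (σ := Empty) (R := ℂ)).mapMatrix
      (Matrix.of fun a b => 𝓜.bracket (f a) (g b)))
    (μ := 𝓜.ΓL.param) (ν := 𝓜.ΓR.param) (by
      intro a b
      simp only [← map_mul]
      exact hasCoeffIntegral_C (h a b) (bracket_eq _ _).symm)
  have h2 := h1 0
  have hC : ∀ A : Fin N → Fin N → ℂ,
      (Matrix.of fun a i => (MvPowerSeries.C (A a i) : MvPowerSeries Empty ℂ)).det =
        MvPowerSeries.C (Matrix.of A).det := fun A => (RingHom.map_det _ _).symm
  have hN : (N.factorial : MvPowerSeries Empty ℂ) = MvPowerSeries.C (N.factorial : ℂ) := by simp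
  simp only [hC, ← RingHom.map_det, ← map_mul, hN, ← map_pow, MvPowerSeries.coeff_zero_C] at h2
  exact h2

/-- Row operations replace the powers in a Vandermonde determinant by any monic family; Andréief
does the rest. -/
lemma partitionFunction_eq_det (h : 𝓜.Converges) {P Q : ℕ → ℂ[X]} (hP : IsMonicFamily P)
    (hQ : IsMonicFamily Q) (N : ℕ) : 𝓜.partitionFunction N =
      (Matrix.of fun a b : Fin N =>
        𝓜.bracket (fun x => (P a).eval x) (fun y => (Q b).eval y)).det := by
  have h1 := (det_mul_det_weight_mul_det (𝓜 := 𝓜) (N := N) (f := fun a x => (P a).eval x)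
    (g := fun b y => (Q b).eval y) fun a b => h.bracketIntegrable_eval _ _).2
  have hV : ∀ {P : ℕ → ℂ[X]}, IsMonicFamily P → ∀ x : Fin N → ℂ,
      (Matrix.of fun (a i : Fin N) => (P a).eval (x i)).det = (Matrix.vandermonde x).det := by
    intro P hP x
    rw [det_eval_matrixOfPolynomials_eq_det_vandermonde x (fun a => P a) (fun i => (hP i).2)
      (fun i => (hP i).1), ← det_transpose]
    rfl
  simp only [hV hP, hV hQ] at h1
  have h2 := fun t => eigIntegrand_density_mul (𝓜 := 𝓜) (N := N) (fun _ _ => 1) t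
  simp only [mul_one] at h2
  rw [partitionFunction, eigIntegral]
  simp only [mul_right_comm] at h1 h2
  have h3 : (N.factorial : ℂ) ≠ 0 := Nat.cast_ne_zero.2 N.factorial_ne_zero
  rw [show (𝓜.eigIntegrand N (𝓜.density N)) =
    𝓜.eigIntegrand N (fun x y => 𝓜.density N x y) from rfl, funext h2, h1]
  field_simp

lemma IsBiorthogonal.partitionFunction_eq (hc : 𝓜.Converges) {P Q : ℕ → ℂ[X]} {h : ℕ → ℂ}
    (hb : 𝓜.IsBiorthogonal P Q h) (N : ℕ) : 𝓜.partitionFunction N = ∏ i : Fin N, h i := by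
  rw [partitionFunction_eq_det hc hb.monic_left hb.monic_right, ← det_diagonal]
  congr 1
  ext a b
  simp [hb.orthogonal, diagonal_apply, Fin.val_inj]

lemma inversePair_eq {N M : ℕ} (z w : Fin M → ℂ) (x y : Fin N → ℂ) :
    inversePair z w x y = (∏ α, ∏ i, (z α - x i)⁻¹) * ∏ α, ∏ i, (w α - y i)⁻¹ := by
  have h : ∀ (x : Fin N → ℂ) (z : ℂ), (charDet x z)⁻¹ = ∏ i, (z - x i)⁻¹ := fun x z => by
    rw [charDet, smul_one_eq_diagonal, diagonal_sub, det_diagonal, prod_inv_distrib]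
  simp only [inversePair, h, prod_mul_distrib]

/-- Column `i` carries the common factor `∏_α (z_α - x_i)⁻¹`. This absorbs the observable into the
Vandermonde determinant for every `M` and `N`. -/
lemma det_prod_inv_mul_pow {M N : ℕ} (z : Fin M → ℂ) (x : Fin N → ℂ) :
    (Matrix.of fun a i : Fin N => (∏ α, (z α - x i)⁻¹) * (X ^ (a : ℕ) : ℂ[X]).eval (x i)).det =
      (Matrix.vandermonde x).det * ∏ α, ∏ i, (z α - x i)⁻¹ := by
  rw [prod_comm, mul_comm, ← det_mul_pow]
  simp only [eval_pow, eval_X]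

/-- The inverse pair correlation as a determinant of brackets. -/
theorem expectation_inversePair (h : 𝓜.Converges) {N M : ℕ} {z w : Fin M → ℂ}
    (hz : ∀ α, z α ∉ 𝓜.ΓL.support) (hw : ∀ α, w α ∉ 𝓜.ΓR.support) :
    𝓜.HasExpectation N (inversePair z w) ∧
    𝓜.expectation N (inversePair z w) = (𝓜.partitionFunction N)⁻¹ *
      (Matrix.of fun a b : Fin N => 𝓜.bracket
        (fun x => (∏ α, (z α - x)⁻¹) * (X ^ (a : ℕ) : ℂ[X]).eval x)
        (fun y => (∏ α, (w α - y)⁻¹) * (X ^ (b : ℕ) : ℂ[X]).eval y)).det := by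
  have h1 := det_mul_det_weight_mul_det (𝓜 := 𝓜) (N := N)
    (f := fun a x => (∏ α, (z α - x)⁻¹) * (X ^ (a : ℕ) : ℂ[X]).eval x)
    (g := fun b y => (∏ α, (w α - y)⁻¹) * (X ^ (b : ℕ) : ℂ[X]).eval y)
    fun a b => h.bracketIntegrable_rational _ _ hz hw _ _
  have h2 : ∀ t, 𝓜.eigIntegrand N (fun x y => 𝓜.density N x y * inversePair z w x y) t = _ :=
    fun t => eigIntegrand_density_mul _ t
  simp only [det_prod_inv_mul_pow] at h1
  have h3 : 𝓜.eigIntegrand N (fun x y => 𝓜.density N x y * inversePair z w x y) = fun t =>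
      (Matrix.vandermonde fun i => 𝓜.ΓL.path (t.1 i)).det *
        (∏ α, ∏ i, (z α - 𝓜.ΓL.path (t.1 i))⁻¹) *
        (Matrix.of fun i j => 𝓜.weight (t.1 i) (t.2 j)).det *
        ((Matrix.vandermonde fun i => 𝓜.ΓR.path (t.2 i)).det *
          ∏ α, ∏ i, (w α - 𝓜.ΓR.path (t.2 i))⁻¹) := by
    ext t
    rw [h2, inversePair_eq]
    ring
  have h4 : (N.factorial : ℂ) ≠ 0 := Nat.cast_ne_zero.2 N.factorial_ne_zero
  rw [← h3] at h1
  refine ⟨hasExpectation_of_integrable h1.1, ?_⟩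
  rw [expectation_eq, h1.2]
  field_simp

lemma resolventMatrix_eq {M : ℕ} (z w : Fin M → ℂ) (α β : Fin M) :
    𝓜.resolventMatrix z w α β = 𝓜.bracket (fun x => (z α - x)⁻¹) (fun y => (w β - y)⁻¹) := by
  simp [resolventMatrix]

/-- Since `a < N ≤ M = N + K`, the functions `x^a / ∏ (z_α - x)` are pure combinations of simple
poles. The brackets form the leading block of `U S Vᵀ`, and the minor identity applies. -/
theorem expectation_inversePair_of_le (h : 𝓜.Converges) {N K : ℕ}
    {p q : ℕ → ℂ[X]} (hp : IsMonicFamily p)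
    (hq : IsMonicFamily q) {z w : Fin (N + K) → ℂ} (hzi : Function.Injective z)
    (hwi : Function.Injective w) (hz : ∀ α, z α ∉ 𝓜.ΓL.support) (hw : ∀ α, w α ∉ 𝓜.ΓR.support)
    (hS : 0 < K → IsUnit (𝓜.resolventMatrix z w).det) :
    𝓜.expectation N (inversePair z w) =
      (𝓜.partitionFunction N)⁻¹ / (vandermonde z * vandermonde w) * (𝓜.resolventMatrix z w).det *
        (Matrix.of fun a b : Fin K => ∑ α, ∑ β,
          (p a).eval (z α) * (𝓜.resolventMatrix z w)⁻¹ β α * (q b).eval (w β)).det := by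
  have key := det_sum_weightedVandermonde_mul hzi hwi hp hq (𝓜.resolventMatrix z w) hS
  have hpf : ∀ {Γ : Contour} {z : Fin (N + K) → ℂ}, Function.Injective z →
      (∀ α, z α ∉ Γ.support) → ∀ a : Fin N, ∀ t ∈ Γ.dom,
      (∏ α, (z α - Γ.path t)⁻¹) * (X ^ (a : ℕ) : ℂ[X]).eval (Γ.path t) =
        ∑ α, weightedVandermonde z (Fin.castAdd K a) α * (z α - Γ.path t)⁻¹ := by
    intro Γ z hzi hz a t ht
    rw [mul_comm, ← sum_eval_mul_nodeWeight_mul_inv hzi (fun α => Γ.ne_path (hz α) ht)]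
    · simp [weightedVandermonde]
    · rw [degree_X_pow]
      exact_mod_cast (by omega : (a : ℕ) < N + K)
  have hB : ∀ a b : Fin N, 𝓜.bracket
        (fun x => (∏ α, (z α - x)⁻¹) * (X ^ (a : ℕ) : ℂ[X]).eval x)
        (fun y => (∏ α, (w α - y)⁻¹) * (X ^ (b : ℕ) : ℂ[X]).eval y) =
      ∑ α, ∑ β, weightedVandermonde z (Fin.castAdd K a) α * 𝓜.resolventMatrix z w α β *
        weightedVandermonde w (Fin.castAdd K b) β := by
    intro a b
    rw [bracket_congr
      (f' := fun x => ∑ α, weightedVandermonde z (Fin.castAdd K a) α * (z α - x)⁻¹)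
      (g' := fun y => ∑ β, weightedVandermonde w (Fin.castAdd K b) β * (w β - y)⁻¹)
      (hpf hzi hz a) (hpf hwi hw b), bracket_sum_left fun α _ =>
      BracketIntegrable.sum_right (fun β _ => h.bracketIntegrable_inv_inv (hz α) (hw β)) _]
    refine sum_congr rfl fun α _ => ?_
    rw [bracket_sum_right fun β _ => h.bracketIntegrable_inv_inv (hz α) (hw β), mul_sum]
    exact sum_congr rfl fun β _ => by rw [resolventMatrix_eq]; ring
  rw [(expectation_inversePair h hz hw).2, vandermonde_mul_vandermonde]
  simp only [hB]
  have hz0 : (Matrix.vandermonde z).det ≠ 0 := det_vandermonde_ne_zero_iff.2 hzi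
  have hw0 : (Matrix.vandermonde w).det ≠ 0 := det_vandermonde_ne_zero_iff.2 hwi
  rw [div_mul_eq_mul_div, div_mul_eq_mul_div, eq_div_iff (mul_ne_zero hz0 hw0), mul_assoc, key]
  ring

/-! ### The analytic formula for `M ≤ N` -/

section Kernel

variable {P Q : ℕ → ℂ[X]} {h : ℕ → ℂ}

lemma IsBiorthogonal.sqrt_mul_sqrt (hb : 𝓜.IsBiorthogonal P Q h) (i : ℕ) :
    (h i) ^ (1 / 2 : ℂ) * (h i) ^ (1 / 2 : ℂ) = h i := by
  rw [← Complex.cpow_add _ _ (hb.norm_ne_zero i)]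
  norm_num

lemma pairing_exp_mul_ψ (f : ℂ → ℂ) (i : ℕ) :
    𝓜.pairing (fun x => Complex.exp (-𝓜.VL.eval x) * f x) (𝓜.ψ Q h i) =
      ((h i) ^ (1 / 2 : ℂ))⁻¹ * 𝓜.bracket f (fun y => (Q i).eval y) := by
  rw [pairing, bracket, integral₂, integral₂, ← integral_const_mul]
  congr 1
  ext t
  simp only [ψ]
  ring

lemma pairing_φ_exp_mul (g : ℂ → ℂ) (i : ℕ) :
    𝓜.pairing (𝓜.φ P h i) (fun y => Complex.exp (-𝓜.VR.eval y) * g y) =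
      ((h i) ^ (1 / 2 : ℂ))⁻¹ * 𝓜.bracket (fun x => (P i).eval x) g := by
  rw [pairing, bracket, integral₂, integral₂, ← integral_const_mul]
  congr 1
  ext t
  simp only [φ]
  ring

/-- The kernels contain the root of `h i` only through this product, so the choice of branch is
immaterial. -/
lemma IsBiorthogonal.inv_sqrt_mul_inv_sqrt (hb : 𝓜.IsBiorthogonal P Q h) (i : ℕ) :
    ((h i) ^ (1 / 2 : ℂ))⁻¹ * ((h i) ^ (1 / 2 : ℂ))⁻¹ = (h i)⁻¹ := by
  rw [← mul_inv, hb.sqrt_mul_sqrt]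

/-- The completeness relation says that the biorthogonal expansion of the bracket converges. -/
lemma IsBiorthogonal.tendsto_sum_of_isCompleteOn (hb : 𝓜.IsBiorthogonal P Q h) {f g : ℂ → ℂ}
    (hf : ∀ q : ℂ[X], 𝓜.BracketIntegrable f (fun y => q.eval y))
    (hg : ∀ p : ℂ[X], 𝓜.BracketIntegrable (fun x => p.eval x) g)
    (hfg : 𝓜.IsCompleteOn P Q h f g) :
    Filter.Tendsto (fun n => ∑ i ∈ range n, 𝓜.bracket f (fun y => (Q i).eval y) * (h i)⁻¹ *
      𝓜.bracket (fun x => (P i).eval x) g) Filter.atTop (nhds (𝓜.bracket f g)) := by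
  refine Filter.Tendsto.congr (fun n => ?_) hfg
  have h1 : ∀ i, Integrable (fun t : (ℝ × ℝ) × (ℝ × ℝ) =>
      (f (𝓜.ΓL.path t.1.1) * 𝓜.weight t.1.1 t.1.2 * (Q i).eval (𝓜.ΓR.path t.1.2)) *
        ((P i).eval (𝓜.ΓL.path t.2.1) * 𝓜.weight t.2.1 t.2.2 * g (𝓜.ΓR.path t.2.2)))
      ((𝓜.ΓL.param.prod 𝓜.ΓR.param).prod (𝓜.ΓL.param.prod 𝓜.ΓR.param)) := fun i =>
    (hf (Q i)).mul_prod (hg (P i))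
  -- Each term of `K_n` factorizes, so the fourfold integral is a product of two brackets.
  have h2 : ∀ i, 𝓜.bracket f (fun y => (Q i).eval y) * (h i)⁻¹ *
      𝓜.bracket (fun x => (P i).eval x) g = ∫ t : (ℝ × ℝ) × (ℝ × ℝ), (h i)⁻¹ *
      ((f (𝓜.ΓL.path t.1.1) * 𝓜.weight t.1.1 t.1.2 * (Q i).eval (𝓜.ΓR.path t.1.2)) *
        ((P i).eval (𝓜.ΓL.path t.2.1) * 𝓜.weight t.2.1 t.2.2 * g (𝓜.ΓR.path t.2.2)))
      ∂((𝓜.ΓL.param.prod 𝓜.ΓR.param).prod (𝓜.ΓL.param.prod 𝓜.ΓR.param)) := fun i => by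
    rw [integral_const_mul, bracket_eq, bracket_eq, mul_comm _ (h i)⁻¹, mul_assoc,
      ← integral_prod_mul]
  rw [sum_congr rfl fun i _ => h2 i, ← integral_finsetSum _ fun i _ => (h1 i).const_mul _]
  congr 1
  ext t
  rw [cdKernel, mul_sum, sum_mul, sum_mul, sum_mul]
  refine sum_congr rfl fun i _ => ?_
  rw [← hb.inv_sqrt_mul_inv_sqrt]
  simp only [weight, φ, ψ]
  ring

lemma IsBiorthogonal.dualKernelTerm_eq (hb : 𝓜.IsBiorthogonal P Q h) (n : ℕ) (w z : ℂ) (i : ℕ) :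
    𝓜.dualKernelTerm P Q h n w z i = Complex.exp (𝓜.VL.eval z) * Complex.exp (𝓜.VR.eval w) *
      (𝓜.bracket (fun x => (z - x)⁻¹) (fun y => (Q (n + i)).eval y) * (h (n + i))⁻¹ *
        𝓜.bracket (fun x => (P (n + i)).eval x) (fun y => (w - y)⁻¹)) := by
  rw [dualKernelTerm, dualψ, dualφ, pairing_exp_mul_ψ, pairing_φ_exp_mul,
    ← hb.inv_sqrt_mul_inv_sqrt]
  simp only [one_div]
  ring

/-- The tail of the biorthogonal expansion is its limit minus the first `n` terms. Completeness
controls only ordered partial sums, hence conditional summation. -/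
lemma IsBiorthogonal.hasSum_dualKernelTerm (hb : 𝓜.IsBiorthogonal P Q h) (hc : 𝓜.Converges)
    {z w : ℂ} (hz : z ∉ 𝓜.ΓL.support) (hw : w ∉ 𝓜.ΓR.support)
    (hfg : 𝓜.IsCompleteOn P Q h (fun x => 1 / (z - x)) (fun y => 1 / (w - y))) (n : ℕ) :
    HasSum (𝓜.dualKernelTerm P Q h n w z) (Complex.exp (𝓜.VL.eval z) * Complex.exp (𝓜.VR.eval w) *
      (𝓜.bracket (fun x => (z - x)⁻¹) (fun y => (w - y)⁻¹) - ∑ i : Fin n,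
        𝓜.bracket (fun x => (z - x)⁻¹) (fun y => (Q i).eval y) * (h i)⁻¹ *
        𝓜.bracket (fun x => (P i).eval x) (fun y => (w - y)⁻¹)))
      (SummationFilter.conditional ℕ) := by
  simp only [one_div] at hfg
  have h1 := hb.tendsto_sum_of_isCompleteOn (fun q => hc.bracketIntegrable_inv_eval q hz)
    (fun p => hc.bracketIntegrable_eval_inv p hw) hfg
  rw [HasSum, SummationFilter.conditional_filter_eq_map_range, Filter.tendsto_map'_iff]
  have h2 := ((h1.comp (Filter.tendsto_add_atTop_nat n)).sub_const (∑ i ∈ range n,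
    𝓜.bracket (fun x => (z - x)⁻¹) (fun y => (Q i).eval y) * (h i)⁻¹ *
      𝓜.bracket (fun x => (P i).eval x) (fun y => (w - y)⁻¹))).const_mul
    (Complex.exp (𝓜.VL.eval z) * Complex.exp (𝓜.VR.eval w))
  rw [Fin.sum_univ_eq_sum_range (fun i => 𝓜.bracket (fun x => (z - x)⁻¹)
    (fun y => (Q i).eval y) * (h i)⁻¹ * 𝓜.bracket (fun x => (P i).eval x) (fun y => (w - y)⁻¹)) n]
  refine h2.congr fun m => ?_
  simp only [Function.comp_apply]
  rw [add_comm m n, sum_range_add, add_sub_cancel_left, mul_sum]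
  exact sum_congr rfl fun i _ => (hb.dualKernelTerm_eq n w z i).symm

/-- The rows of the confluent Cauchy determinant. -/
noncomputable def resolventFamily {M : ℕ} (K : ℕ) (z : Fin M → ℂ) (P : ℕ → ℂ[X])
    (a : Fin (M + K)) (x : ℂ) : ℂ :=
  Sum.elim (fun α => (z α - x)⁻¹) (fun j : Fin K => (P j).eval x) (finSumFinEquiv.symm a)

lemma resolventFamily_inl {M : ℕ} (K : ℕ) (z : Fin M → ℂ) (P : ℕ → ℂ[X]) (α : Fin M) :
    resolventFamily K z P (finSumFinEquiv (Sum.inl α)) = fun x => (z α - x)⁻¹ := by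
  ext x
  rw [resolventFamily, Equiv.symm_apply_apply, Sum.elim_inl]

lemma resolventFamily_inr {M : ℕ} (K : ℕ) (z : Fin M → ℂ) (P : ℕ → ℂ[X]) (j : Fin K) :
    resolventFamily K z P (finSumFinEquiv (Sum.inr j)) = fun x => (P j).eval x := by
  ext x
  rw [resolventFamily, Equiv.symm_apply_apply, Sum.elim_inr]

lemma det_resolventFamily {M K : ℕ} {Γ : Contour} {z : Fin M → ℂ} (hzi : Function.Injective z)
    (hz : ∀ α, z α ∉ Γ.support) (hP : IsMonicFamily P) {t : Fin (M + K) → ℝ}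
    (ht : ∀ i, t i ∈ Γ.dom) :
    (Matrix.of fun a i => resolventFamily K z P a (Γ.path (t i))).det =
      ((cauchySign M K : ℤ) : ℂ) * ((Matrix.vandermonde z).det *
        ((Matrix.vandermonde fun i => Γ.path (t i)).det * ∏ α, ∏ i, (z α - Γ.path (t i))⁻¹)) := by
  rw [← det_cauchyMatrix_mul hzi hP (fun α i => Γ.ne_path (hz α) (ht i)),
    ← det_submatrix_equiv_self finSumFinEquiv]
  congr 1
  ext a i
  simp [resolventFamily, cauchyMatrix]

/-- The Cauchy determinant needs `z α ≠ Γ.path t`, which can fail only at parameters outside `dom`;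
these are null. -/
lemma ae_eigParam_mem_dom {N : ℕ} : ∀ᵐ t ∂(𝓜.eigParam N),
    (∀ i, t.1 i ∈ 𝓜.ΓL.dom) ∧ ∀ i, t.2 i ∈ 𝓜.ΓR.dom := by
  have h : ∀ Γ : Contour, ∀ᵐ t ∂(Measure.pi fun _ : Fin N => Γ.param), ∀ i, t i ∈ Γ.dom :=
    fun Γ => ae_all_iff.2 fun i =>
      (Measure.quasiMeasurePreserving_eval (fun _ => Γ.param) i).ae Γ.ae_mem_dom
  exact (Measure.quasiMeasurePreserving_fst.ae (h _)).and
    (Measure.quasiMeasurePreserving_snd.ae (h _))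

/-- Multiplied by the Vandermonde determinants of `z` and `w`, the integrand is a product of two
confluent Cauchy determinants and the weight determinant. Andréief and the Schur complement of
`diag(h_i)`, `i < K`, produce `Z_K` and the tail of the expansion. -/
theorem IsBiorthogonal.expectation_inversePair (hb : 𝓜.IsBiorthogonal P Q h) (hc : 𝓜.Converges)
    {M K : ℕ} {z w : Fin M → ℂ} (hzi : Function.Injective z) (hwi : Function.Injective w)
    (hz : ∀ α, z α ∉ 𝓜.ΓL.support) (hw : ∀ α, w α ∉ 𝓜.ΓR.support)
    (hcomp : ∀ α β, 𝓜.IsCompleteOn P Q h (fun x => 1 / (z α - x)) (fun y => 1 / (w β - y))) :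
    𝓜.expectation (M + K) (inversePair z w) =
      Complex.exp (-∑ α, 𝓜.VL.eval (z α)) * Complex.exp (-∑ α, 𝓜.VR.eval (w α)) /
        (vandermonde z * vandermonde w) *
        (𝓜.partitionFunction K / 𝓜.partitionFunction (M + K)) *
        (Matrix.of fun α β => 𝓜.dualKernel P Q h K (w β) (z α)).det := by
  set V := (Matrix.vandermonde z).det * (Matrix.vandermonde w).det with hV
  have hV0 : V ≠ 0 :=
    mul_ne_zero (det_vandermonde_ne_zero_iff.2 hzi) (det_vandermonde_ne_zero_iff.2 hwi)
  have hint : ∀ a b, 𝓜.BracketIntegrable (resolventFamily K z P a) (resolventFamily K w Q b) := by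
    intro a b
    obtain ⟨a, rfl⟩ := finSumFinEquiv.surjective a
    obtain ⟨b, rfl⟩ := finSumFinEquiv.surjective b
    rcases a with a | a <;> rcases b with b | b <;>
      simp only [resolventFamily_inl, resolventFamily_inr]
    · exact hc.bracketIntegrable_inv_inv (hz a) (hw b)
    · exact hc.bracketIntegrable_inv_eval _ (hz a)
    · exact hc.bracketIntegrable_eval_inv _ (hw b)
    · exact hc.bracketIntegrable_eval _ _
  have h1 := (det_mul_det_weight_mul_det hint).2
  have h2 : V * ∫ t, 𝓜.eigIntegrand (M + K)
      (fun x y => 𝓜.density (M + K) x y * inversePair z w x y) t ∂(𝓜.eigParam (M + K)) =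
      ((M + K).factorial : ℂ) ^ 2 * (Matrix.of fun a b =>
        𝓜.bracket (resolventFamily K z P a) (resolventFamily K w Q b)).det := by
    rw [← h1, ← integral_const_mul]
    refine integral_congr_ae ?_
    filter_upwards [ae_eigParam_mem_dom] with t ht
    rw [det_resolventFamily hzi hz hb.monic_left ht.1,
      det_resolventFamily hwi hw hb.monic_right ht.2, eigIntegrand_density_mul, inversePair_eq, hV]
    -- The left and right Cauchy determinants carry the same sign.
    have := units_int_cast_mul_self (R := ℂ) (cauchySign M K)
    generalize ((cauchySign M K : ℤ) : ℂ) = ε at this ⊢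
    rw [← one_mul (_ * _), ← this]
    ring
  have h3 : (Matrix.of fun a b =>
      𝓜.bracket (resolventFamily K z P a) (resolventFamily K w Q b)).det =
      𝓜.partitionFunction K * (Matrix.of fun α β : Fin M =>
        𝓜.bracket (fun x => (z α - x)⁻¹) (fun y => (w β - y)⁻¹) - ∑ i : Fin K,
        𝓜.bracket (fun x => (z α - x)⁻¹) (fun y => (Q i).eval y) * (h i)⁻¹ *
        𝓜.bracket (fun x => (P i).eval x) (fun y => (w β - y)⁻¹)).det := by
    have := det_fromBlocks_diagonal
      (Matrix.of fun α β : Fin M => 𝓜.bracket (fun x => (z α - x)⁻¹) (fun y => (w β - y)⁻¹))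
      (Matrix.of fun (α : Fin M) (i : Fin K) =>
        𝓜.bracket (fun x => (z α - x)⁻¹) (fun y => (Q i).eval y))
      (Matrix.of fun (i : Fin K) (β : Fin M) =>
        𝓜.bracket (fun x => (P i).eval x) (fun y => (w β - y)⁻¹))
      (fun i => h i) (fun i => (h i)⁻¹) fun i => mul_inv_cancel₀ (hb.norm_ne_zero i)
    simp only [of_apply] at this
    rw [hb.partitionFunction_eq hc, ← this, ← det_submatrix_equiv_self finSumFinEquiv]
    congr 1
    ext a b
    rcases a with a | a <;> rcases b with b | b <;>
      simp only [resolventFamily_inl, resolventFamily_inr, submatrix_apply, of_apply, fromBlocks_apply₁₁, fromBlocks_apply₁₂, fromBlocks_apply₂₁,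
        fromBlocks_apply₂₂]
    rw [hb.orthogonal, diagonal_apply]
    simp [Fin.val_inj]
  -- The factor in `z α` belongs to a row and the one in `w β` to a column; both leave the
  -- determinant and later cancel the exponential prefactor.
  have h4 : (Matrix.of fun α β => 𝓜.dualKernel P Q h K (w β) (z α)).det =
      (∏ α, Complex.exp (𝓜.VL.eval (z α))) * (∏ β, Complex.exp (𝓜.VR.eval (w β))) *
      (Matrix.of fun α β : Fin M =>
        𝓜.bracket (fun x => (z α - x)⁻¹) (fun y => (w β - y)⁻¹) - ∑ i : Fin K,
        𝓜.bracket (fun x => (z α - x)⁻¹) (fun y => (Q i).eval y) * (h i)⁻¹ *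
        𝓜.bracket (fun x => (P i).eval x) (fun y => (w β - y)⁻¹)).det := by
    rw [mul_comm (∏ α, _) (∏ β, _), mul_assoc, ← det_mul_column, ← det_mul_row]
    congr 1
    ext α β
    simp only [of_apply, dualKernel]
    rw [(hb.hasSum_dualKernelTerm hc (hz α) (hw β) (hcomp α β) K).tsum_eq]
    ring
  have hN : ((M + K).factorial : ℂ) ≠ 0 := Nat.cast_ne_zero.2 (M + K).factorial_ne_zero
  have hE : ∀ x : ℂ, Complex.exp (-x) * Complex.exp x = 1 := fun x => by
    rw [← Complex.exp_add]; simp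
  rw [expectation_eq, h4, vandermonde_mul_vandermonde, ← hV, ← Complex.exp_sum, ← Complex.exp_sum]
  rw [h3] at h2
  rw [← mul_right_inj' hV0, mul_left_comm, h2]
  have e1 := hE (∑ α, 𝓜.VL.eval (z α))
  have e2 := hE (∑ α, 𝓜.VR.eval (w α))
  generalize (Matrix.of (fun α β : Fin M => _ - _) : Matrix (Fin M) (Fin M) ℂ).det = D
  rw [div_mul_eq_mul_div, mul_left_comm _ ((_ : ℂ) ^ 2), mul_div_cancel_left₀ _ (pow_ne_zero 2 hN),
    div_mul_eq_mul_div, div_mul_eq_mul_div, mul_div_cancel₀ _ hV0]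
  linear_combination (-(𝓜.partitionFunction K / 𝓜.partitionFunction (M + K) * D)) *
    (e1 * (Complex.exp (-∑ α, 𝓜.VR.eval (w α)) * Complex.exp (∑ α, 𝓜.VR.eval (w α))) + e2)

end Kernel

end Model

/-! ### The Cauchy determinant expanded at infinity -/

section FormalCauchy

variable {σ : Type*}

lemma cauchySeries_mul (s : σ) (x : ℂ) :
    cauchySeries s x * (1 - MvPowerSeries.C x * MvPowerSeries.X s) = MvPowerSeries.X s := by
  rw [cauchySeries, mul_assoc, MvPowerSeries.inv_mul_cancel, mul_one]
  simp

lemma coeff_cauchySeries [DecidableEq σ] (s : σ) (x : ℂ) (e : σ →₀ ℕ) :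
    MvPowerSeries.coeff e (cauchySeries s x) = MvPowerSeries.coeff e (MvPowerSeries.X s) +
      x * ∑ p ∈ antidiagonal e, MvPowerSeries.coeff p.1 (MvPowerSeries.X s) *
        MvPowerSeries.coeff p.2 (cauchySeries s x) := by
  have h : cauchySeries s x = MvPowerSeries.X s +
      MvPowerSeries.C x * (MvPowerSeries.X s * cauchySeries s x) := by
    linear_combination cauchySeries_mul s x
  conv_lhs => rw [h, map_add, MvPowerSeries.coeff_C_mul, MvPowerSeries.coeff_mul]

/-- The coefficients of `1 / (z - x)` at `z = ∞` are polynomials in `x` of small degree. -/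
lemma exists_coeff_cauchySeries (s : σ) (e : σ →₀ ℕ) :
    ∃ p : ℂ[X], p.degree < e.degree ∧
      ∀ x, MvPowerSeries.coeff e (cauchySeries s x) = p.eval x := by
  classical
  induction hn : e.degree using Nat.strong_induction_on generalizing e with
  | _ n ih =>
  have h1 : ∃ p : ℂ[X], p.degree < n ∧
      ∀ x, MvPowerSeries.coeff e (MvPowerSeries.X s) = p.eval x := by
    rw [MvPowerSeries.coeff_X]
    split_ifs with he
    · refine ⟨1, ?_, by simp⟩
      rw [degree_one]
      have : e.degree = 1 := by rw [he]; simp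
      rw [← hn, this]; norm_num
    · exact ⟨0, by simp [bot_lt_iff_ne_bot], by simp⟩
  have h2 : ∀ p ∈ antidiagonal e, ∃ q : ℂ[X], q.degree < n ∧ ∀ x,
      x * (MvPowerSeries.coeff p.1 (MvPowerSeries.X s) *
        MvPowerSeries.coeff p.2 (cauchySeries s x)) = q.eval x := by
    intro p hp
    rw [MvPowerSeries.coeff_X]
    split_ifs with he
    -- Removing the variable lowers the order by one, which pays for the additional factor `x`.
    · have hd : p.2.degree + 1 = n := by
        have h3 := congrArg Finsupp.degree (mem_antidiagonal.1 hp)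
        rw [map_add, he, hn] at h3
        simp at h3
        omega
      obtain ⟨q, hq, hq'⟩ := ih p.2.degree (by omega) p.2 rfl
      refine ⟨X * q, ?_, fun x => by simp [hq']⟩
      rcases eq_or_ne q 0 with rfl | hq0
      · simp [bot_lt_iff_ne_bot]
      · rw [degree_eq_natDegree hq0] at hq
        rw [degree_mul, degree_X, degree_eq_natDegree hq0, ← hd, add_comm]
        norm_cast at hq ⊢
        omega
    · exact ⟨0, by simp [bot_lt_iff_ne_bot], by simp⟩
  obtain ⟨p, hp, hp'⟩ := h1
  choose! q hq hq' using h2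
  refine ⟨p + ∑ a ∈ antidiagonal e, q a, ?_, fun x => ?_⟩
  · refine (degree_add_le _ _).trans_lt (max_lt hp ?_)
    refine (degree_sum_le _ _).trans_lt ?_
    rw [Finset.sup_lt_iff (by simp [bot_lt_iff_ne_bot])]
    exact hq
  · rw [coeff_cauchySeries, eval_add, eval_finsetSum, ← hp', mul_sum]
    congr 1
    exact sum_congr rfl fun a ha => hq' a ha x

/-- Pairwise, `u_i u_j (u_j⁻¹ - u_i⁻¹) = u_i - u_j`, and each index lies in `M - 1` pairs. These
powers clear the denominators of `Δ_M(Z)`, with no extra sign. -/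
lemma prod_pow_mul_det_vandermonde_inv {F : Type*} [Field F] {M : ℕ} {u : Fin M → F}
    (hu : ∀ α, u α ≠ 0) :
    (∏ α, u α ^ (M - 1)) * (Matrix.vandermonde fun α => (u α)⁻¹).det = vandermonde u := by
  have h1 : ∏ α, u α ^ (M - 1) = ∏ i, ∏ j ∈ Ioi i, u i * u j := by
    rw [prod_prod_Ioi_mul_eq_prod_prod_off_diag (fun _ i => u i)]
    simp [card_compl]
  rw [h1, det_vandermonde, vandermonde, ← prod_mul_distrib]
  refine prod_congr rfl fun i _ => ?_
  rw [← prod_mul_distrib]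
  refine prod_congr rfl fun j _ => ?_
  have := hu i
  have := hu j
  field_simp

/-- The rows of the formal confluent Cauchy determinant. -/
noncomputable def cauchyFamily {M : ℕ} (K : ℕ) (s : Fin M → σ) (P : ℕ → ℂ[X]) (a : Fin (M + K))
    (x : ℂ) : MvPowerSeries σ ℂ :=
  Sum.elim (fun α => cauchySeries (s α) x) (fun j : Fin K => MvPowerSeries.C ((P j).eval x))
    (finSumFinEquiv.symm a)

lemma cauchyFamily_inl {M : ℕ} (K : ℕ) (s : Fin M → σ) (P : ℕ → ℂ[X]) (α : Fin M) :
    cauchyFamily K s P (finSumFinEquiv (Sum.inl α)) = cauchySeries (s α) := by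
  ext x
  rw [cauchyFamily, Equiv.symm_apply_apply, Sum.elim_inl]

lemma cauchyFamily_inr {M : ℕ} (K : ℕ) (s : Fin M → σ) (P : ℕ → ℂ[X]) (j : Fin K) :
    cauchyFamily K s P (finSumFinEquiv (Sum.inr j)) =
      fun x => MvPowerSeries.C ((P j).eval x) := by
  ext1 x
  rw [cauchyFamily, Equiv.symm_apply_apply, Sum.elim_inr]

/-- In the fraction field of the power series ring, `cauchySeries` is the inverse of `u⁻¹ - x`. The
identity is therefore the Cauchy determinant at the nodes `u_α⁻¹`, pulled back along an injective
map. -/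
theorem prod_pow_mul_det_cauchyFamily {M K : ℕ} {s : Fin M → σ} (hs : Function.Injective s)
    {P : ℕ → ℂ[X]} (hP : IsMonicFamily P) (x : Fin (M + K) → ℂ) :
    (∏ α, (MvPowerSeries.X (s α) : MvPowerSeries σ ℂ) ^ (M - 1)) *
        (Matrix.of fun a i => cauchyFamily K s P a (x i)).det =
      ((cauchySign M K : ℤ) : MvPowerSeries σ ℂ) *
        (vandermonde (fun α => (MvPowerSeries.X (s α) : MvPowerSeries σ ℂ)) *
          (MvPowerSeries.C (Matrix.vandermonde x).det * ∏ α, ∏ i, cauchySeries (s α) (x i))) := by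
  let F := FractionRing (MvPowerSeries σ ℂ)
  let φ : MvPowerSeries σ ℂ →+* F := algebraMap _ _
  have hφ : Function.Injective φ := IsFractionRing.injective (MvPowerSeries σ ℂ) F
  let ψ : ℂ →+* F := φ.comp MvPowerSeries.C
  let u : Fin M → F := fun α => φ (MvPowerSeries.X (s α))
  have hu : ∀ α, u α ≠ 0 := fun α => by
    rw [Ne, map_eq_zero_iff φ hφ]
    intro h
    simpa using congrArg (MvPowerSeries.coeff (Finsupp.single (s α) 1)) h
  have hui : Function.Injective fun α => (u α)⁻¹ := fun α β h => by
    exact hs (MvPowerSeries.X_inj.1 (hφ (inv_injective h)))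
  have hκ : ∀ α x, φ (cauchySeries (s α) x) * ((u α)⁻¹ - ψ x) = 1 := fun α x => by
    have := congrArg φ (cauchySeries_mul (s α) x)
    simp only [map_mul, map_sub, map_one] at this
    have h0 := hu α
    change _ * (1 - ψ x * u α) = u α at this
    rw [← mul_left_inj' h0, one_mul]
    linear_combination this + φ (cauchySeries (s α) x) * inv_mul_cancel₀ h0
  have hne : ∀ α i, (u α)⁻¹ ≠ ψ (x i) := fun α i h => by
    have := hκ α (x i)
    simp [h] at this
  have hκ' : ∀ α i, φ (cauchySeries (s α) (x i)) = ((u α)⁻¹ - ψ (x i))⁻¹ := fun α i =>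
    eq_inv_of_mul_eq_one_left (hκ α (x i))
  have h1 := det_cauchyMatrix_mul (K := K) hui (P := fun i => (P i).map ψ)
    (fun i => ⟨(hP i).1.map ψ, by rw [(hP i).1.natDegree_map, (hP i).2]⟩) hne
  have h2 : φ (Matrix.of fun a i => cauchyFamily K s P a (x i)).det =
      ((cauchyMatrix (fun α => (u α)⁻¹) (fun i => (P i).map ψ) fun i => ψ (x i)).submatrix id
        finSumFinEquiv : Matrix (Fin M ⊕ Fin K) (Fin M ⊕ Fin K) F).det := by
    rw [RingHom.map_det, ← det_submatrix_equiv_self finSumFinEquiv]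
    congr 1
    ext a i
    rcases a with a | a
    · simp only [RingHom.mapMatrix_apply, submatrix_apply, map_apply, of_apply, cauchyFamily_inl,
        cauchyMatrix, id, Sum.elim_inl, hκ']
    · simp only [RingHom.mapMatrix_apply, submatrix_apply, map_apply, of_apply, cauchyFamily_inr,
        cauchyMatrix, id, Sum.elim_inr, eval_map]
      exact (Polynomial.eval₂_at_apply ψ _).symm
  apply hφ
  have h3 : φ (vandermonde fun α => (MvPowerSeries.X (s α) : MvPowerSeries σ ℂ)) =
      vandermonde u := by
    simp [vandermonde, u]
  have h4 : φ (MvPowerSeries.C (Matrix.vandermonde x).det) =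
      (Matrix.vandermonde fun i => ψ (x i)).det := by
    exact (det_vandermonde_map ψ x).symm
  rw [map_mul, h2, h1, map_mul, map_mul, map_mul, h3, h4, map_intCast, map_prod,
    ← prod_pow_mul_det_vandermonde_inv hu]
  simp only [map_prod, hκ', map_pow]
  change (∏ α, u α ^ (M - 1)) * _ = _
  ring

end FormalCauchy

lemma IsMonicFamily.exists_eq_sum {Q : ℕ → ℂ[X]} (hQ : IsMonicFamily Q) (d : ℕ) (g : ℂ[X])
    (hg : g.degree < d) : ∃ c : ℕ → ℂ, g = ∑ j ∈ range d, C (c j) * Q j := by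
  induction d generalizing g with
  | zero =>
    refine ⟨0, ?_⟩
    rw [range_zero, sum_empty, ← degree_eq_bot]
    simpa [degree_lt_iff_coeff_zero, Polynomial.ext_iff] using hg
  | succ d ih =>
    obtain ⟨c, hc⟩ := ih (g - C (g.coeff d) * Q d) (by
      rw [degree_lt_iff_coeff_zero] at hg ⊢
      intro m hm
      rw [coeff_sub, coeff_C_mul]
      rcases hm.eq_or_lt with rfl | hm
      · have := (hQ d).1.coeff_natDegree
        rw [(hQ d).2] at this
        rw [this]; ring
      · rw [hg m hm, coeff_eq_zero_of_natDegree_lt (p := Q d) (by rw [(hQ d).2]; exact hm)]; ring)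
    refine ⟨fun j => if j = d then g.coeff d else c j, ?_⟩
    beta_reduce
    rw [sum_range_succ, if_pos rfl, ← sub_eq_iff_eq_add, hc]
    exact sum_congr rfl fun j hj => by rw [if_neg (mem_range.1 hj).ne]

/-- A function with values in power series whose coefficients are polynomials. -/
def IsPolynomialSeries {σ : Type*} (f : ℂ → MvPowerSeries σ ℂ) : Prop :=
  ∀ e, ∃ p : ℂ[X], ∀ x, MvPowerSeries.coeff e (f x) = p.eval x

namespace IsPolynomialSeries

variable {σ : Type*}

lemma C_eval (p : ℂ[X]) :
    IsPolynomialSeries fun x => (MvPowerSeries.C (p.eval x) : MvPowerSeries σ ℂ) := by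
  classical
  intro e
  simp only [MvPowerSeries.coeff_C]
  split_ifs
  · exact ⟨p, fun _ => rfl⟩
  · exact ⟨0, by simp⟩

lemma cauchySeries (s : σ) : IsPolynomialSeries (cauchySeries s) := fun e =>
  let ⟨p, _, h⟩ := exists_coeff_cauchySeries s e
  ⟨p, h⟩

lemma mul {f g : ℂ → MvPowerSeries σ ℂ} (hf : IsPolynomialSeries f) (hg : IsPolynomialSeries g) :
    IsPolynomialSeries fun x => f x * g x := by
  classical
  intro e
  choose p hp using hf
  choose q hq using hg
  exact ⟨∑ a ∈ antidiagonal e, p a.1 * q a.2, fun x => by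
    simp [MvPowerSeries.coeff_mul, hp, hq, eval_finsetSum]⟩

lemma prod {ι : Type*} (s : Finset ι) {f : ι → ℂ → MvPowerSeries σ ℂ}
    (hf : ∀ i, IsPolynomialSeries (f i)) : IsPolynomialSeries fun x => ∏ i ∈ s, f i x := by
  classical
  induction s using Finset.induction_on with
  | empty => simpa using C_eval (σ := σ) 1
  | insert i s hi ih => simpa only [prod_insert hi] using (hf i).mul ih

lemma cauchyFamily {M K : ℕ} (s : Fin M → σ) (P : ℕ → ℂ[X]) (a : Fin (M + K)) :
    IsPolynomialSeries (cauchyFamily K s P a) := by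
  obtain ⟨a, rfl⟩ := finSumFinEquiv.surjective a
  rcases a with a | a
  · rw [cauchyFamily_inl]; exact cauchySeries _
  · rw [cauchyFamily_inr]; exact C_eval _

end IsPolynomialSeries

/-! ### Coefficientwise brackets -/

namespace Model

variable {𝓜 : Model} {σ : Type*} [DecidableEq σ]

/-- The coefficientwise bracket of functions with values in power series. -/
noncomputable def formalBracket (𝓜 : Model) (f g : ℂ → MvPowerSeries σ ℂ) : MvPowerSeries σ ℂ :=
  fun e => ∑ p ∈ antidiagonal e, 𝓜.bracket (fun x => MvPowerSeries.coeff p.1 (f x))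
    (fun y => MvPowerSeries.coeff p.2 (g y))

lemma coeff_formalBracket (f g : ℂ → MvPowerSeries σ ℂ) (e : σ →₀ ℕ) :
    MvPowerSeries.coeff e (𝓜.formalBracket f g) = ∑ p ∈ antidiagonal e,
      𝓜.bracket (fun x => MvPowerSeries.coeff p.1 (f x))
        (fun y => MvPowerSeries.coeff p.2 (g y)) := rfl

/-- Each coefficient is a finite sum of polynomials in `x` times polynomials in `y`, so convergence
on monomials suffices. -/
lemma Converges.hasCoeffIntegral (h : 𝓜.Converges) {f g : ℂ → MvPowerSeries σ ℂ}
    (hf : IsPolynomialSeries f) (hg : IsPolynomialSeries g) :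
    HasCoeffIntegral (fun t : ℝ × ℝ => f (𝓜.ΓL.path t.1) * MvPowerSeries.C (𝓜.weight t.1 t.2) *
      g (𝓜.ΓR.path t.2)) (𝓜.formalBracket f g) (𝓜.ΓL.param.prod 𝓜.ΓR.param) := by
  intro e
  choose p hp using hf
  choose q hq using hg
  have h1 : ∀ t : ℝ × ℝ, MvPowerSeries.coeff e (f (𝓜.ΓL.path t.1) *
      MvPowerSeries.C (𝓜.weight t.1 t.2) * g (𝓜.ΓR.path t.2)) = ∑ a ∈ antidiagonal e,
      (p a.1).eval (𝓜.ΓL.path t.1) * 𝓜.weight t.1 t.2 * (q a.2).eval (𝓜.ΓR.path t.2) :=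
    fun t => by
      simp only [MvPowerSeries.coeff_mul, ← hp, ← hq]
      simp only [← MvPowerSeries.coeff_mul, MvPowerSeries.coeff_mul_C]
  have h2 := fun a : (σ →₀ ℕ) × (σ →₀ ℕ) => h.bracketIntegrable_eval (p a.1) (q a.2)
  simp only [h1]
  refine ⟨integrable_finsetSum _ fun a _ => h2 a, ?_⟩
  rw [integral_finsetSum _ fun a _ => h2 a, coeff_formalBracket]
  refine sum_congr rfl fun a _ => ?_
  simp only [hp, hq, bracket_eq]

lemma Converges.hasCoeffIntegral_det (hc : 𝓜.Converges) {N : ℕ}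
    {f g : Fin N → ℂ → MvPowerSeries σ ℂ} (hf : ∀ a, IsPolynomialSeries (f a))
    (hg : ∀ a, IsPolynomialSeries (g a)) :
    HasCoeffIntegral (fun t : (Fin N → ℝ) × (Fin N → ℝ) =>
      (Matrix.of fun a i => f a (𝓜.ΓL.path (t.1 i))).det *
        MvPowerSeries.C (Matrix.of fun i j => 𝓜.weight (t.1 i) (t.2 j)).det *
        (Matrix.of fun a i => g a (𝓜.ΓR.path (t.2 i))).det)
      ((N.factorial : MvPowerSeries σ ℂ) ^ 2 *
        (Matrix.of fun a b => 𝓜.formalBracket (f a) (g b)).det) (𝓜.eigParam N) :=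
  hasCoeffIntegral_det_mul_det_mul_det (f := fun a s => f a (𝓜.ΓL.path s))
    (g := fun a s => g a (𝓜.ΓR.path s)) (w := 𝓜.weight)
    (B := Matrix.of fun a b => 𝓜.formalBracket (f a) (g b))
    fun a b => hc.hasCoeffIntegral (hf a) (hg b)

lemma coeff_formalBracket_C_right (f : ℂ → MvPowerSeries σ ℂ) (g : ℂ → ℂ) (e : σ →₀ ℕ) :
    MvPowerSeries.coeff e (𝓜.formalBracket f fun y => MvPowerSeries.C (g y)) =
      𝓜.bracket (fun x => MvPowerSeries.coeff e (f x)) g := by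
  rw [coeff_formalBracket, sum_eq_single (e, 0)]
  · simp
  · rintro ⟨a, b⟩ hab hne
    have hb : b ≠ 0 := by
      rintro rfl
      simp at hab
      simp [hab] at hne
    simp [MvPowerSeries.coeff_C, hb, bracket_eq]
  · simp

lemma coeff_formalBracket_C_left (f : ℂ → ℂ) (g : ℂ → MvPowerSeries σ ℂ) (e : σ →₀ ℕ) :
    MvPowerSeries.coeff e (𝓜.formalBracket (fun x => MvPowerSeries.C (f x)) g) =
      𝓜.bracket f (fun y => MvPowerSeries.coeff e (g y)) := by
  rw [coeff_formalBracket, sum_eq_single (0, e)]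
  · simp
  · rintro ⟨a, b⟩ hab hne
    have hb : a ≠ 0 := by
      rintro rfl
      simp at hab
      simp [hab] at hne
    simp [MvPowerSeries.coeff_C, hb, bracket_eq]
  · simp

lemma formalBracket_C_C (f g : ℂ → ℂ) :
    𝓜.formalBracket (fun x => (MvPowerSeries.C (f x) : MvPowerSeries σ ℂ))
      (fun y => MvPowerSeries.C (g y)) = MvPowerSeries.C (𝓜.bracket f g) := by
  ext e
  rw [coeff_formalBracket_C_right, MvPowerSeries.coeff_C]
  split_ifs with h
  · simp [h]
  · simp [MvPowerSeries.coeff_C, h, bracket_eq]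

/-! ### The formal formula for `M ≤ N` -/

section Kernel

variable {P Q : ℕ → ℂ[X]} {h : ℕ → ℂ}

lemma IsBiorthogonal.bracket_eq_zero (hb : 𝓜.IsBiorthogonal P Q h) (hc : 𝓜.Converges) {i : ℕ}
    {g : ℂ[X]} (hg : g.degree < i) : 𝓜.bracket (fun x => (P i).eval x) (fun y => g.eval y) = 0 := by
  obtain ⟨c, rfl⟩ := hb.monic_right.exists_eq_sum i g hg
  simp only [eval_finsetSum, eval_mul, eval_C]
  rw [bracket_sum_right fun j _ => hc.bracketIntegrable_eval _ _]
  exact sum_eq_zero fun j hj => by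
    rw [hb.orthogonal, if_neg (mem_range.1 hj).ne', mul_zero]

/-- Completeness of the biorthogonal polynomials on polynomials. -/
lemma IsBiorthogonal.sum_bracket_mul_bracket (hb : 𝓜.IsBiorthogonal P Q h) (hc : 𝓜.Converges)
    {d : ℕ} (f : ℂ[X]) {g : ℂ[X]} (hg : g.degree < d) :
    ∑ i ∈ range d, 𝓜.bracket (fun x => f.eval x) (fun y => (Q i).eval y) * (h i)⁻¹ *
      𝓜.bracket (fun x => (P i).eval x) (fun y => g.eval y) =
      𝓜.bracket (fun x => f.eval x) (fun y => g.eval y) := by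
  obtain ⟨c, rfl⟩ := hb.monic_right.exists_eq_sum d g hg
  simp only [eval_finsetSum, eval_mul, eval_C]
  rw [bracket_sum_right fun j _ => hc.bracketIntegrable_eval _ _]
  refine sum_congr rfl fun i hi => ?_
  rw [bracket_sum_right fun j _ => hc.bracketIntegrable_eval _ _]
  simp only [hb.orthogonal]
  rw [sum_congr rfl (g := fun j => if i = j then c j * h i else 0) (fun j _ => by split_ifs <;> simp),
    sum_ite_eq, if_pos hi]
  field_simp [hb.norm_ne_zero i]

variable {M : ℕ}

lemma coeff_formalDualφ (i : ℕ) (α : Fin M) (e : Fin M ⊕ Fin M →₀ ℕ) :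
    MvPowerSeries.coeff e (𝓜.formalDualφ Q h i α) = 𝓜.pairing
      (fun x => Complex.exp (-𝓜.VL.eval x) *
        MvPowerSeries.coeff e (cauchySeries (Sum.inl α : Fin M ⊕ Fin M) x)) (𝓜.ψ Q h i) := rfl

lemma coeff_formalDualψ (i : ℕ) (β : Fin M) (e : Fin M ⊕ Fin M →₀ ℕ) :
    MvPowerSeries.coeff e (𝓜.formalDualψ P h i β) = 𝓜.pairing (𝓜.φ P h i)
      (fun y => Complex.exp (-𝓜.VR.eval y) *
        MvPowerSeries.coeff e (cauchySeries (Sum.inr β : Fin M ⊕ Fin M) y)) := rfl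

lemma formalDualφ_eq (i : ℕ) (α : Fin M) : 𝓜.formalDualφ Q h i α =
    MvPowerSeries.C ((h i) ^ (1 / 2 : ℂ))⁻¹ * 𝓜.formalBracket
      (cauchySeries (Sum.inl α : Fin M ⊕ Fin M)) (fun y => MvPowerSeries.C ((Q i).eval y)) := by
  ext e
  rw [MvPowerSeries.coeff_C_mul, coeff_formalBracket_C_right, coeff_formalDualφ,
    pairing_exp_mul_ψ]

lemma formalDualψ_eq (i : ℕ) (β : Fin M) : 𝓜.formalDualψ P h i β =
    MvPowerSeries.C ((h i) ^ (1 / 2 : ℂ))⁻¹ * 𝓜.formalBracket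
      (fun x => MvPowerSeries.C ((P i).eval x)) (cauchySeries (Sum.inr β : Fin M ⊕ Fin M)) := by
  ext e
  rw [MvPowerSeries.coeff_C_mul, coeff_formalBracket_C_left, coeff_formalDualψ,
    pairing_φ_exp_mul]

/-- The `i`-th term of the biorthogonal expansion of the formal bracket. -/
noncomputable def formalTerm (𝓜 : Model) (P Q : ℕ → ℂ[X]) (h : ℕ → ℂ) (α β : Fin M) (i : ℕ) :
    MvPowerSeries (Fin M ⊕ Fin M) ℂ :=
  𝓜.formalBracket (cauchySeries (Sum.inl α)) (fun y => MvPowerSeries.C ((Q i).eval y)) *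
    MvPowerSeries.C (h i)⁻¹ *
    𝓜.formalBracket (fun x => MvPowerSeries.C ((P i).eval x)) (cauchySeries (Sum.inr β))

lemma IsBiorthogonal.formalDualKernelTerm_eq (hb : 𝓜.IsBiorthogonal P Q h) (n : ℕ) (β α : Fin M)
    (i : ℕ) : 𝓜.formalDualKernelTerm P Q h n β α i = 𝓜.formalTerm P Q h α β (n + i) := by
  rw [formalDualKernelTerm, formalDualφ_eq, formalDualψ_eq, formalTerm, ← hb.inv_sqrt_mul_inv_sqrt,
    map_mul]
  ring

lemma coeff_formalTerm (α β : Fin M) (i : ℕ) (e : Fin M ⊕ Fin M →₀ ℕ) :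
    MvPowerSeries.coeff e (𝓜.formalTerm P Q h α β i) = ∑ p ∈ antidiagonal e,
      𝓜.bracket (fun x => MvPowerSeries.coeff p.1 (cauchySeries (Sum.inl α : Fin M ⊕ Fin M) x))
        (fun y => (Q i).eval y) * (h i)⁻¹ *
      𝓜.bracket (fun x => (P i).eval x)
        (fun y => MvPowerSeries.coeff p.2 (cauchySeries (Sum.inr β : Fin M ⊕ Fin M) y)) := by
  rw [formalTerm, MvPowerSeries.coeff_mul]
  refine sum_congr rfl fun p _ => ?_
  rw [MvPowerSeries.coeff_mul_C, coeff_formalBracket_C_right, coeff_formalBracket_C_left]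

/-- The right-hand coefficients contributing to `e` are polynomials of degree below `e.degree`,
hence orthogonal to `P_i` for `i ≥ e.degree`. -/
lemma IsBiorthogonal.coeff_formalTerm_eq_zero (hb : 𝓜.IsBiorthogonal P Q h) (hc : 𝓜.Converges)
    (α β : Fin M) {i : ℕ} {e : Fin M ⊕ Fin M →₀ ℕ} (hi : e.degree ≤ i) :
    MvPowerSeries.coeff e (𝓜.formalTerm P Q h α β i) = 0 := by
  rw [coeff_formalTerm]
  refine sum_eq_zero fun p hp => ?_
  obtain ⟨g, hg, hg'⟩ := exists_coeff_cauchySeries (Sum.inr β : Fin M ⊕ Fin M) p.2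
  simp only [hg']
  rw [hb.bracket_eq_zero hc, mul_zero]
  have := congrArg Finsupp.degree (mem_antidiagonal.1 hp)
  rw [map_add] at this
  exact hg.trans_le (by exact_mod_cast (by omega : p.2.degree ≤ i))

/-- The formal substitute for completeness: at a fixed order only polynomials are paired, and on
them the biorthogonal expansion terminates. -/
lemma IsBiorthogonal.sum_coeff_formalTerm (hb : 𝓜.IsBiorthogonal P Q h) (hc : 𝓜.Converges)
    (α β : Fin M) (e : Fin M ⊕ Fin M →₀ ℕ) :
    ∑ i ∈ range e.degree, MvPowerSeries.coeff e (𝓜.formalTerm P Q h α β i) =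
      MvPowerSeries.coeff e (𝓜.formalBracket (cauchySeries (Sum.inl α : Fin M ⊕ Fin M))
        (cauchySeries (Sum.inr β))) := by
  simp only [coeff_formalTerm]
  rw [sum_comm, coeff_formalBracket]
  refine sum_congr rfl fun p hp => ?_
  obtain ⟨f, -, hf⟩ := exists_coeff_cauchySeries (Sum.inl α : Fin M ⊕ Fin M) p.1
  obtain ⟨g, hg, hg'⟩ := exists_coeff_cauchySeries (Sum.inr β : Fin M ⊕ Fin M) p.2
  simp only [hf, hg']
  refine hb.sum_bracket_mul_bracket hc f ?_
  have := congrArg Finsupp.degree (mem_antidiagonal.1 hp)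
  rw [map_add] at this
  exact hg.trans_le (by exact_mod_cast (by omega : p.2.degree ≤ e.degree))

lemma IsBiorthogonal.finite_support_formalDualKernelTerm (hb : 𝓜.IsBiorthogonal P Q h)
    (hc : 𝓜.Converges) (n : ℕ) (α β : Fin M) (e : Fin M ⊕ Fin M →₀ ℕ) :
    (Function.support fun i : ℕ =>
      MvPowerSeries.coeff e (𝓜.formalDualKernelTerm P Q h n β α i)).Finite := by
  refine (Set.finite_lt_nat e.degree).subset fun i hi => ?_
  by_contra hlt
  simp only [Set.mem_ofPred_eq, not_lt] at hlt
  refine hi (show MvPowerSeries.coeff e _ = 0 from ?_)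
  rw [hb.formalDualKernelTerm_eq, hb.coeff_formalTerm_eq_zero hc]
  omega

lemma IsBiorthogonal.formalDualKernel_eq (hb : 𝓜.IsBiorthogonal P Q h) (hc : 𝓜.Converges) (n : ℕ)
    (α β : Fin M) : 𝓜.formalDualKernel P Q h n β α =
      𝓜.formalBracket (cauchySeries (Sum.inl α : Fin M ⊕ Fin M)) (cauchySeries (Sum.inr β)) -
        ∑ i : Fin n, 𝓜.formalTerm P Q h α β i := by
  ext e
  rw [map_sub, map_sum, ← hb.sum_coeff_formalTerm hc,
    Fin.sum_univ_eq_sum_range (fun i => MvPowerSeries.coeff e (𝓜.formalTerm P Q h α β i)) n]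
  change ∑' i, MvPowerSeries.coeff e (𝓜.formalDualKernelTerm P Q h n β α i) = _
  simp only [hb.formalDualKernelTerm_eq]
  have h0 : ∀ i, i ∉ range e.degree → MvPowerSeries.coeff e (𝓜.formalTerm P Q h α β i) = 0 :=
    fun i hi => hb.coeff_formalTerm_eq_zero hc α β (by simpa using hi)
  -- Reading the finite sum as the full series lets it split at any `n`, even one beyond `e.degree`.
  rw [← (hasSum_sum_of_ne_finset_zero (L := .unconditional ℕ) h0).tsum_eq, eq_sub_iff_add_eq, add_comm]
  simp only [add_comm n]
  exact (summable_of_ne_finset_zero h0).sum_add_tsum_nat_add n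

lemma formalInversePairCorrelation_eq {N M : ℕ} {r : MvPowerSeries (Fin M ⊕ Fin M) ℂ}
    (hr : HasCoeffIntegral (fun t : (Fin N → ℝ) × (Fin N → ℝ) =>
      MvPowerSeries.C ((Matrix.vandermonde fun i => 𝓜.ΓL.path (t.1 i)).det *
        (Matrix.vandermonde fun i => 𝓜.ΓR.path (t.2 i)).det *
        (Matrix.of fun i j => 𝓜.weight (t.1 i) (t.2 j)).det) *
        ((∏ α : Fin M, ∏ i, cauchySeries (Sum.inl α : Fin M ⊕ Fin M) (𝓜.ΓL.path (t.1 i))) *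
          ∏ α : Fin M, ∏ i, cauchySeries (Sum.inr α : Fin M ⊕ Fin M) (𝓜.ΓR.path (t.2 i)))) r
      (𝓜.eigParam N)) :
    𝓜.formalInversePairCorrelation N M =
      MvPowerSeries.C ((𝓜.partitionFunction N)⁻¹ / (N.factorial : ℂ) ^ 2) * r := by
  ext e
  rw [MvPowerSeries.coeff_C_mul, ← (hr e).2]
  change 𝓜.expectation N _ = _
  rw [expectation_eq]
  congr 2
  ext t
  rw [eigIntegrand_density_mul, MvPowerSeries.coeff_C_mul, prod_mul_distrib]

/-- The inverse pair correlation at infinity as an integral. -/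
lemma Converges.hasCoeffIntegral_inversePair (hc : 𝓜.Converges) (N M : ℕ) :
    ∃ r, HasCoeffIntegral (fun t : (Fin N → ℝ) × (Fin N → ℝ) =>
      MvPowerSeries.C ((Matrix.vandermonde fun i => 𝓜.ΓL.path (t.1 i)).det *
        (Matrix.vandermonde fun i => 𝓜.ΓR.path (t.2 i)).det *
        (Matrix.of fun i j => 𝓜.weight (t.1 i) (t.2 j)).det) *
        ((∏ α : Fin M, ∏ i, cauchySeries (Sum.inl α : Fin M ⊕ Fin M) (𝓜.ΓL.path (t.1 i))) *
          ∏ α : Fin M, ∏ i, cauchySeries (Sum.inr α : Fin M ⊕ Fin M) (𝓜.ΓR.path (t.2 i)))) r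
      (𝓜.eigParam N) := by
  have hp : ∀ (s : Fin M → Fin M ⊕ Fin M) (a : Fin N), IsPolynomialSeries fun x =>
      (∏ α, cauchySeries (s α) x) * MvPowerSeries.C ((X ^ (a : ℕ) : ℂ[X]).eval x) := fun s a =>
    (IsPolynomialSeries.prod _ fun α => .cauchySeries _).mul (.C_eval _)
  have hV : ∀ (s : Fin M → Fin M ⊕ Fin M) (x : Fin N → ℂ),
      (Matrix.of fun a i : Fin N => (∏ α, cauchySeries (s α) (x i)) *
        MvPowerSeries.C ((X ^ (a : ℕ) : ℂ[X]).eval (x i))).det =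
      (∏ α, ∏ i, cauchySeries (s α) (x i)) * MvPowerSeries.C (Matrix.vandermonde x).det := by
    intro s x
    simp only [eval_pow, eval_X, map_pow]
    rw [det_mul_pow, prod_comm, det_vandermonde_map]
  have h1 := hc.hasCoeffIntegral_det (hp Sum.inl) (hp Sum.inr)
  refine ⟨_, h1.congr fun t => ?_⟩
  rw [hV, hV]
  simp only [map_mul]
  ring

/-- Two evaluations of one coefficientwise integral: the correlation multiplied by `Δ_M(u) Δ_M(v)`,
and the product of the two formal Cauchy determinants multiplied by `∏ (u_α v_α)^(M-1)`. -/
theorem IsBiorthogonal.formalInversePairCorrelation (hb : 𝓜.IsBiorthogonal P Q h)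
    (hc : 𝓜.Converges) (M K : ℕ) :
    vandermonde (fun α : Fin M =>
        (MvPowerSeries.X (Sum.inl α) : MvPowerSeries (Fin M ⊕ Fin M) ℂ)) *
      vandermonde (fun α : Fin M =>
        (MvPowerSeries.X (Sum.inr α) : MvPowerSeries (Fin M ⊕ Fin M) ℂ)) *
      𝓜.formalInversePairCorrelation (M + K) M =
    (∏ α : Fin M, (MvPowerSeries.X (Sum.inl α) * MvPowerSeries.X (Sum.inr α)) ^ (M - 1)) *
      ((𝓜.partitionFunction K / 𝓜.partitionFunction (M + K)) •
        (Matrix.of fun α β : Fin M => 𝓜.formalDualKernel P Q h K β α).det) := by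
  obtain ⟨r, hr⟩ := hc.hasCoeffIntegral_inversePair (M + K) M
  rw [formalInversePairCorrelation_eq hr]
  have h1 := hc.hasCoeffIntegral_det
    (IsPolynomialSeries.cauchyFamily (K := K) (Sum.inl : Fin M → Fin M ⊕ Fin M) P)
    (IsPolynomialSeries.cauchyFamily (K := K) (Sum.inr : Fin M → Fin M ⊕ Fin M) Q)
  have h2 := h1.const_mul
    (∏ α : Fin M, (MvPowerSeries.X (Sum.inl α) * MvPowerSeries.X (Sum.inr α)) ^ (M - 1))
  have h3 := hr.const_mul (vandermonde (fun α : Fin M =>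
        (MvPowerSeries.X (Sum.inl α) : MvPowerSeries (Fin M ⊕ Fin M) ℂ)) *
      vandermonde (fun α : Fin M =>
        (MvPowerSeries.X (Sum.inr α) : MvPowerSeries (Fin M ⊕ Fin M) ℂ)))
  have h4 := HasCoeffIntegral.unique h3 h2 fun t => by
    have hl := prod_pow_mul_det_cauchyFamily (σ := Fin M ⊕ Fin M) (K := K) Sum.inl_injective
      hb.monic_left fun i => 𝓜.ΓL.path (t.1 i)
    have hr := prod_pow_mul_det_cauchyFamily (σ := Fin M ⊕ Fin M) (K := K) Sum.inr_injective
      hb.monic_right fun i => 𝓜.ΓR.path (t.2 i)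
    have hε := units_int_cast_mul_self (R := MvPowerSeries (Fin M ⊕ Fin M) ℂ) (cauchySign M K)
    simp only [mul_pow, prod_mul_distrib, map_mul]
    generalize (Matrix.of fun a i => cauchyFamily K Sum.inl P a (𝓜.ΓL.path (t.1 i))).det = Df at *
    generalize (Matrix.of fun a i => cauchyFamily K Sum.inr Q a (𝓜.ΓR.path (t.2 i))).det = Dg at *
    generalize MvPowerSeries.C (Matrix.of fun i j => 𝓜.weight (t.1 i) (t.2 j)).det = W
    generalize ((cauchySign M K : ℤ) : MvPowerSeries (Fin M ⊕ Fin M) ℂ) = ε at *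
    rw [show ∀ A B : MvPowerSeries (Fin M ⊕ Fin M) ℂ, A * B * (Df * W * Dg) =
      (A * Df) * (B * Dg) * W from fun A B => by ring, hl, hr]
    rw [show ∀ A B : MvPowerSeries (Fin M ⊕ Fin M) ℂ, (ε * A) * (ε * B) * W =
      (ε * ε) * (A * B * W) from fun A B => by ring, hε]
    ring
  -- The Schur complement over the power series ring: the polynomial block consists of the constants
  -- `h_i`, which stay invertible there.
  have h5 : (Matrix.of fun a b => 𝓜.formalBracket
      (cauchyFamily K (Sum.inl : Fin M → Fin M ⊕ Fin M) P a)
      (cauchyFamily K (Sum.inr : Fin M → Fin M ⊕ Fin M) Q b)).det =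
      MvPowerSeries.C (𝓜.partitionFunction K) *
        (Matrix.of fun α β : Fin M => 𝓜.formalDualKernel P Q h K β α).det := by
    have := det_fromBlocks_diagonal
      (Matrix.of fun α β : Fin M => 𝓜.formalBracket
        (cauchySeries (Sum.inl α : Fin M ⊕ Fin M)) (cauchySeries (Sum.inr β)))
      (Matrix.of fun (α : Fin M) (i : Fin K) => 𝓜.formalBracket
        (cauchySeries (Sum.inl α : Fin M ⊕ Fin M)) (fun y => MvPowerSeries.C ((Q i).eval y)))
      (Matrix.of fun (i : Fin K) (β : Fin M) => 𝓜.formalBracket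
        (fun x => MvPowerSeries.C ((P i).eval x)) (cauchySeries (Sum.inr β : Fin M ⊕ Fin M)))
      (fun i => MvPowerSeries.C (h i)) (fun i => MvPowerSeries.C (h i)⁻¹) fun i => by
        rw [← map_mul, mul_inv_cancel₀ (hb.norm_ne_zero i), map_one]
    simp only [of_apply] at this
    simp only [hb.formalDualKernel_eq hc, formalTerm]
    rw [hb.partitionFunction_eq hc, map_prod, ← this, ← det_submatrix_equiv_self finSumFinEquiv]
    congr 1
    ext1 a b
    rcases a with a | a <;> rcases b with b | b <;>
      simp only [cauchyFamily_inl, cauchyFamily_inr, submatrix_apply, of_apply,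
        fromBlocks_apply₁₁, fromBlocks_apply₁₂, fromBlocks_apply₂₁, fromBlocks_apply₂₂]
    rw [formalBracket_C_C, hb.orthogonal, diagonal_apply]
    split_ifs <;> simp_all [Fin.val_inj]
  rw [h5] at h4
  have hN : ((M + K).factorial : ℂ) ≠ 0 := Nat.cast_ne_zero.2 (M + K).factorial_ne_zero
  rw [mul_left_comm, h4, MvPowerSeries.smul_eq_C_mul, mul_left_comm]
  congr 1
  rw [show ((M + K).factorial : MvPowerSeries (Fin M ⊕ Fin M) ℂ) =
    MvPowerSeries.C ((M + K).factorial : ℂ) by simp, ← map_pow, ← mul_assoc, ← mul_assoc,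
    ← map_mul, ← map_mul]
  congr 2
  field_simp

end Kernel

end Model

end CoupledMatrix

/-! ### Assembly of the three statements -/

theorem mainTheorem4 (𝓜 : CoupledMatrix.Model) (hconv : 𝓜.Converges) (N M : ℕ) :
    -- `M ≤ N`, as expansions in `u_α = 1 / z_α`, `v_α = 1 / w_α`; both sides are multiplied by
    -- `Δ_M(Z) Δ_M(W) ∏_α (u_α v_α)^(M - 1) = Δ_M(u) Δ_M(v)`
    (M ≤ N → ∀ (P Q : ℕ → Polynomial ℂ) (h : ℕ → ℂ), 𝓜.IsBiorthogonal P Q h →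
      (∀ (α β : Fin M) (e : Fin M ⊕ Fin M →₀ ℕ), (Function.support fun i : ℕ =>
        MvPowerSeries.coeff e (𝓜.formalDualKernelTerm P Q h (N - M) β α i)).Finite) ∧
      CoupledMatrix.vandermonde
          (fun α : Fin M => (MvPowerSeries.X (Sum.inl α) : MvPowerSeries (Fin M ⊕ Fin M) ℂ)) *
        CoupledMatrix.vandermonde
          (fun α : Fin M => (MvPowerSeries.X (Sum.inr α) : MvPowerSeries (Fin M ⊕ Fin M) ℂ)) *
        𝓜.formalInversePairCorrelation N M =
      (∏ α : Fin M, (MvPowerSeries.X (Sum.inl α) * MvPowerSeries.X (Sum.inr α)) ^ (M - 1)) *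
        ((𝓜.partitionFunction (N - M) / 𝓜.partitionFunction N) •
          (Matrix.of fun α β : Fin M => 𝓜.formalDualKernel P Q h (N - M) β α).det)) ∧
    -- `M ≤ N`, as functions of `z_α`, `w_α`, under the completeness relation
    (M ≤ N → ∀ (P Q : ℕ → Polynomial ℂ) (h : ℕ → ℂ), 𝓜.IsBiorthogonal P Q h →
      ∀ z w : Fin M → ℂ, Function.Injective z → Function.Injective w →
      (∀ α, z α ∉ 𝓜.ΓL.support) → (∀ α, w α ∉ 𝓜.ΓR.support) →
      (∀ α β, 𝓜.IsCompleteOn P Q h (fun x => 1 / (z α - x)) (fun y => 1 / (w β - y))) →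
      𝓜.HasExpectation N (CoupledMatrix.Model.inversePair z w) ∧
      (∀ α β, Summable (𝓜.dualKernelTerm P Q h (N - M) (w β) (z α))
        (SummationFilter.conditional ℕ)) ∧
      𝓜.expectation N (CoupledMatrix.Model.inversePair z w) =
        Complex.exp (-∑ α, 𝓜.VL.eval (z α)) * Complex.exp (-∑ α, 𝓜.VR.eval (w α)) /
            (CoupledMatrix.vandermonde z * CoupledMatrix.vandermonde w) *
          (𝓜.partitionFunction (N - M) / 𝓜.partitionFunction N) *
          (Matrix.of fun α β => 𝓜.dualKernel P Q h (N - M) (w β) (z α)).det) ∧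
    -- `M ≥ N`
    (N ≤ M → 𝓜.partitionFunction N ≠ 0 → ∀ p q : ℕ → Polynomial ℂ,
      CoupledMatrix.IsMonicFamily p → CoupledMatrix.IsMonicFamily q →
      ∀ z w : Fin M → ℂ, Function.Injective z → Function.Injective w →
      (∀ α, z α ∉ 𝓜.ΓL.support) → (∀ α, w α ∉ 𝓜.ΓR.support) →
      (N < M → IsUnit (𝓜.resolventMatrix z w).det) →
      𝓜.HasExpectation N (CoupledMatrix.Model.inversePair z w) ∧
      𝓜.expectation N (CoupledMatrix.Model.inversePair z w) =
        (𝓜.partitionFunction N)⁻¹ /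
            (CoupledMatrix.vandermonde z * CoupledMatrix.vandermonde w) *
          (𝓜.resolventMatrix z w).det *
          (Matrix.of fun a b : Fin (M - N) => ∑ α, ∑ β,
            (p a).eval (z α) * (𝓜.resolventMatrix z w)⁻¹ β α * (q b).eval (w β)).det) := by
  refine ⟨fun hMN P Q h hb => ?_, fun hMN P Q h hb z w hzi hwi hz hw hcomp => ?_,
    fun hNM _ p q hp hq z w hzi hwi hz hw hS => ?_⟩
  · obtain ⟨K, rfl⟩ := Nat.exists_eq_add_of_le hMN
    rw [Nat.add_sub_cancel_left]
    exact ⟨fun α β e => hb.finite_support_formalDualKernelTerm hconv K α β e,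
      hb.formalInversePairCorrelation hconv M K⟩
  · obtain ⟨K, rfl⟩ := Nat.exists_eq_add_of_le hMN
    rw [Nat.add_sub_cancel_left]
    exact ⟨(CoupledMatrix.Model.expectation_inversePair hconv hz hw).1,
      fun α β => (hb.hasSum_dualKernelTerm hconv (hz α) (hw β) (hcomp α β) K).summable,
      hb.expectation_inversePair hconv hzi hwi hz hw hcomp⟩
  · obtain ⟨K, rfl⟩ := Nat.exists_eq_add_of_le hNM
    refine ⟨(CoupledMatrix.Model.expectation_inversePair hconv hz hw).1, ?_⟩
    rw [Nat.add_sub_cancel_left]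
    exact CoupledMatrix.Model.expectation_inversePair_of_le hconv hp hq hzi hwi hz hw
      fun hK => hS (by omega)
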